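/- **Setting.** Let $A\in\mathbb R^{n\times d}$ have rows $a_1,\dots,a_n$, with $n\ge 2$, and let $1\le k\le d$. For $T\subseteq[n]$, $A_T$ is the submatrix formed by the rows in $T$; $A_{1:i}$ is the submatrix of the first $i$ rows. For a matrix $B$, $[B]_k$ is a best approximation of $B$ of rank at most $k$ in Frobenius norm, $B^+$ is the Moore–Penrose pseudoinverse, $\|B\|_2$ the spectral norm, and $\sigma_{\min}(B)$ the smallest *nonzero* singular value. *The coreset.* The set $S=S(A,k)\subseteq[n]$ is produced by one pass over the rows: start with $S=\emptyset$. For $t=1,\dots,n$, with $\lambda=\|A_S-[A_S]_k\|_F^2/k$ (which is $0$ for $S=\emptyset$), add $t$ to $S$ if either $\lambda=0$ and $a_t\notin\mathrm{rowspace}(A_S)$, or $a_t^{\mathsf T}(A_S^{\mathsf T}A_S+\lambda I)^+a_t\ge \frac1{1+1/k}$. *Condition number.* The online rank-$k$ condition number of $A\neq 0$ is $$\kappa=\kappa(A)=\frac{\|A\|_2}{\min_i\sigma_{\min}(A_{1:i})},$$ where $i$ runs over the indices with $A_{1:i}\ne 0$ and $\mathrm{rank}(A_{1:i-1})\le k$.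 (If $\mathrm{rank}(A)>k$ these are the $i\le i^*+1$ with $A_{1:i}\neq0$, where $i^*$ is the largest index with $\mathrm{rank}(A_{1:i^*})=k$; if $\mathrm{rank}(A)\le k$ there is no cut-off.) For $A=0$ put $\kappa=1$. *Cost.* $\Delta=\Delta(A)=\min_{V}\max_{i}d(a_i,V)$, the minimum being over all $k$-dimensional subspaces $V$ of $\mathbb R^d$ and $d$ being the Euclidean distance. **Statement.** There is an absolute constant $C>0$ such that for all $n\ge2$, $1\le k\le d$ and $A\in\mathbb R^{n\times d}$ the following hold. 1. For every unit vector $x\in\mathbb R^d$, $$\frac{\|A_Sx\|_2}{C\sqrt k\,\log(n\kappa)}\le\|A_Sx\|_\infty\le\|Ax\|_\infty\le\|A_Sx\|_2+C\Delta\log(n\kappa),$$ and $$\|Ax\|_\infty\le C\sqrt k\,\log(n\kappa)\,\|A_Sx\|_\infty+C\Delta\log(n\kappa).$$ 2. (Width estimation.) Let $B$ be the matrix with rows $a_1-a_1,\,a_2-a_1,\dots,a_n-a_1$, let $\kappa'=\kappa(B)$ and $S'=S(B,k)$. For every unit vector $x$, the width $w(x)=\max_i\langle a_i,x\rangle-\min_i\langle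 a_i,x\rangle$ and the estimate $w'(x)=\|B_{S'}x\|_\infty$ satisfy $$\frac{w(x)}{2C\sqrt k\,\log(n\kappa')}-\frac{D}{\sqrt k}\le w'(x)\le w(x),$$ both for $D=\Delta(A)$ and for $D=\Delta(B)$. 3. (Löwner–John ellipsoid.) Let $K=\{x\in\mathbb R^d:\|Ax\|_\infty\le1\}$ and let $B(0,1)$ be the closed Euclidean unit ball. If $\Delta<1/(C\log(n\kappa))$ and $E'=\{x:\|A_Sx\|_2\le1-C\Delta\log(n\kappa)\}$, then $$E'\cap B(0,1)\ \subseteq\ K\cap B(0,1)\ \subseteq\ \left(\frac{C\sqrt k\,\log(n\kappa)}{1-C\Delta\log(n\kappa)}\,E'\right)\cap B(0,1).$$ -/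

import Mathlib

noncomputable section

namespace LinfCoreset

/-- The submatrix `A_T` formed by the rows of `A` with index in `T`. -/
def subRows {n d : ℕ} (A : Matrix (Fin n) (Fin d) ℝ) (T : Finset (Fin n)) :
    Matrix T (Fin d) ℝ :=
  A.submatrix (fun i : T => (i : Fin n)) id

/-- The indices of the first `i` rows. -/
def firstRows (n i : ℕ) : Finset (Fin n) :=
  Finset.univ.filter fun t => (t : ℕ) < i

/-- The leading submatrix `A_{1:i}` (all of `A` if `i ≥ n`). -/
abbrev prefixRows {n d : ℕ} (A : Matrix (Fin n) (Fin d) ℝ) (i : ℕ) :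
    Matrix (firstRows n i) (Fin d) ℝ :=
  subRows A (firstRows n i)

/-- The span of the rows of `B`. -/
def rowSpan {m : Type*} {d : ℕ} (B : Matrix m (Fin d) ℝ) : Submodule ℝ (Fin d → ℝ) :=
  Submodule.span ℝ (Set.range fun i => B i)

/-- `‖B - [B]_k‖_F²`: the squared Frobenius distance from `B` to the nearest matrix of
rank at most `k`. -/
def residualSq {m : Type*} [Fintype m] {d : ℕ} (B : Matrix m (Fin d) ℝ) (k : ℕ) : ℝ :=
  ⨅ X : {X : Matrix m (Fin d) ℝ // X.rank ≤ k}, ∑ i, ∑ j, (B i j - X.1 i j) ^ 2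

/-- The Moore–Penrose pseudoinverse of a real symmetric matrix `M`: all nonzero eigenvalues are
inverted and the kernel is kept (in `ℝ` we have `0⁻¹ = 0`). See `pinv_penrose`. -/
def pinv {d : ℕ} (M : Matrix (Fin d) (Fin d) ℝ) : Matrix (Fin d) (Fin d) ℝ :=
  cfc (fun x : ℝ => x⁻¹) M

/-- On symmetric matrices `pinv` satisfies the four Penrose equations, which determine the
Moore–Penrose pseudoinverse. -/
theorem pinv_penrose {d : ℕ} (M : Matrix (Fin d) (Fin d) ℝ) (hM : M.IsSymm) :
    M * pinv M * M = M ∧ pinv M * M * pinv M = pinv M ∧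
      (M * pinv M).IsSymm ∧ (pinv M * M).IsSymm := by
  have hH : IsSelfAdjoint M := by
    rw [isSelfAdjoint_iff, Matrix.star_eq_conjTranspose, Matrix.conjTranspose_eq_transpose_of_trivial]
    exact hM
  have hfin : (spectrum ℝ M).Finite := Matrix.finite_real_spectrum
  have hc : ∀ f : ℝ → ℝ, ContinuousOn f (spectrum ℝ M) := fun f => hfin.continuousOn f
  have hid : cfc (fun x : ℝ => x) M = M := cfc_id' ℝ M hH
  have h1 : M * pinv M = cfc (fun x : ℝ => x * x⁻¹) M := by
    rw [cfc_mul _ _ M (hc _) (hc _), hid, pinv]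
  have h2 : pinv M * M = cfc (fun x : ℝ => x⁻¹ * x) M := by
    rw [cfc_mul _ _ M (hc _) (hc _), hid, pinv]
  have hs : ∀ f : ℝ → ℝ, (cfc f M).IsSymm := by
    intro f
    have h : IsSelfAdjoint (cfc f M) := cfc_predicate f M
    rwa [isSelfAdjoint_iff, Matrix.star_eq_conjTranspose,
      Matrix.conjTranspose_eq_transpose_of_trivial] at h
  refine ⟨?_, ?_, ?_, ?_⟩
  · rw [h1]
    calc cfc (fun x : ℝ => x * x⁻¹) M * M
        = cfc (fun x : ℝ => x * x⁻¹) M * cfc (fun x : ℝ => x) M := by rw [hid]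
      _ = cfc (fun x : ℝ => x * x⁻¹ * x) M := (cfc_mul _ _ M (hc _) (hc _)).symm
      _ = cfc (fun x : ℝ => x) M := by simp only [mul_inv_mul_cancel]
      _ = M := hid
  · rw [h2]
    calc cfc (fun x : ℝ => x⁻¹ * x) M * pinv M
        = cfc (fun x : ℝ => x⁻¹ * x * x⁻¹) M := (cfc_mul _ _ M (hc _) (hc _)).symm
      _ = pinv M := by
        rw [pinv]; congr 1; funext x
        by_cases hx : x = 0
        · simp [hx]
        · field_simp
  · rw [h1]; exact hs _
  · rw [h2]; exact hs _

/-- The ridge parameter `λ = ‖A_S - [A_S]_k‖_F² / k`. It is `0` for `S = ∅`. -/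
def ridge {n d : ℕ} (A : Matrix (Fin n) (Fin d) ℝ) (k : ℕ) (S : Finset (Fin n)) : ℝ :=
  residualSq (subRows A S) k / k

/-- The score `aᵀ (A_Sᵀ A_S + λ I)⁺ a` of a row `a` against the stored rows. -/
def score {n d : ℕ} (A : Matrix (Fin n) (Fin d) ℝ) (k : ℕ) (S : Finset (Fin n))
    (a : Fin d → ℝ) : ℝ :=
  a ⬝ᵥ (pinv ((subRows A S).transpose * subRows A S
    + ridge A k S • (1 : Matrix (Fin d) (Fin d) ℝ))).mulVec a

open Classical in
/-- One step of the streaming algorithm: row `t` arrives when the set `S` is stored. The row is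
added if `λ = 0` and `a_t ∉ rowspace(A_S)`, or else if its score is at least `1/(1+1/k)`. -/
def step {n d : ℕ} (A : Matrix (Fin n) (Fin d) ℝ) (k : ℕ) (S : Finset (Fin n)) (t : Fin n) :
    Finset (Fin n) :=
  if ridge A k S = 0 ∧ A t ∉ rowSpan (subRows A S) then insert t S
  else if 1 / (1 + 1 / (k : ℝ)) ≤ score A k S (A t) then insert t S
  else S

/-- The set `S` returned by the algorithm after processing the rows of `A` in order. -/
def coreset {n d : ℕ} (A : Matrix (Fin n) (Fin d) ℝ) (k : ℕ) : Finset (Fin n) :=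
  (List.finRange n).foldl (step A k) ∅

/-- The Euclidean norm `‖Bx‖₂`. -/
def norm2 {m : Type*} [Fintype m] {d : ℕ} (B : Matrix m (Fin d) ℝ)
    (x : EuclideanSpace ℝ (Fin d)) : ℝ :=
  ‖(WithLp.toLp 2 (B.mulVec x.ofLp) : EuclideanSpace ℝ m)‖

/-- The maximum norm `‖Bx‖_∞` (which is `0` if `B` has no rows). -/
def normInf {m : Type*} [Fintype m] {d : ℕ} (B : Matrix m (Fin d) ℝ)
    (x : EuclideanSpace ℝ (Fin d)) : ℝ :=
  ‖B.mulVec x.ofLp‖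

/-- The spectral norm of `B`. -/
def opNorm {m : Type*} [Fintype m] {d : ℕ} (B : Matrix m (Fin d) ℝ) : ℝ :=
  ‖(Matrix.toEuclideanLin B).toContinuousLinearMap‖

/-- The smallest nonzero singular value of `B` (for `B ≠ 0`). -/
def sigmaMin {m : Type*} [Fintype m] {d : ℕ} (B : Matrix m (Fin d) ℝ) : ℝ :=
  sInf {s : ℝ | s ≠ 0 ∧ ∃ j : ℕ, (Matrix.toEuclideanLin B).singularValues j = s}

open Classical in
/-- The online rank-`k` condition number `‖B‖₂ / min_i σ_min(B_{1:i})`, where `i` runs over the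
lengths `1 ≤ i ≤ n` with `rank B_{1:i-1} ≤ k` and `B_{1:i} ≠ 0`. If `rank B > k`, then these are
exactly the `i ≤ i* + 1` for which `B_{1:i}` has a nonzero singular value, `i*` being the largest
index with `rank B_{1:i*} = k`; if `rank B ≤ k`, then no `i` is cut off. For `B = 0`, which has no
nonzero singular value, the value is `1`. -/
def onlineCond {n d : ℕ} (B : Matrix (Fin n) (Fin d) ℝ) (k : ℕ) : ℝ :=
  if B = 0 then 1
  else opNorm B / sInf {s : ℝ | ∃ i : ℕ, 1 ≤ i ∧ i ≤ n ∧ (prefixRows B (i - 1)).rank ≤ k ∧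
    prefixRows B i ≠ 0 ∧ s = sigmaMin (prefixRows B i)}

/-- `max_i d(a_i, V)`. -/
def maxDist {n d : ℕ} (A : Matrix (Fin n) (Fin d) ℝ)
    (V : Submodule ℝ (EuclideanSpace ℝ (Fin d))) : ℝ :=
  ⨆ i : Fin n, Metric.infDist (WithLp.toLp 2 (A i)) (V : Set (EuclideanSpace ℝ (Fin d)))

/-- The optimal rank-`k` `ℓ_∞` subspace approximation cost
`Δ = min_{dim V = k} max_i d(a_i, V)`. -/
def optCost {n d : ℕ} (A : Matrix (Fin n) (Fin d) ℝ) (k : ℕ) : ℝ :=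
  ⨅ V : {V : Submodule ℝ (EuclideanSpace ℝ (Fin d)) // Module.finrank ℝ V = k}, maxDist A V.1

/-- The matrix `A - a_{i₀}` with rows `a_i - a_{i₀}`. -/
def shift {n d : ℕ} (A : Matrix (Fin n) (Fin d) ℝ) (i₀ : Fin n) : Matrix (Fin n) (Fin d) ℝ :=
  Matrix.of fun i j => A i j - A i₀ j

/-- The width `max_i ⟨a_i, x⟩ - min_i ⟨a_i, x⟩`. -/
def width {n d : ℕ} (A : Matrix (Fin n) (Fin d) ℝ) (x : EuclideanSpace ℝ (Fin d)) : ℝ :=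
  (⨆ i : Fin n, A.mulVec x.ofLp i) - ⨅ i : Fin n, A.mulVec x.ofLp i

/-- `K = {x | ‖Ax‖_∞ ≤ 1}`. -/
def body {n d : ℕ} (A : Matrix (Fin n) (Fin d) ℝ) : Set (EuclideanSpace ℝ (Fin d)) :=
  {x | normInf A x ≤ 1}

/-- The (possibly unbounded) ellipsoid `{x | ‖Bx‖₂ ≤ r}`. -/
def ellipsoid {m : Type*} [Fintype m] {d : ℕ} (B : Matrix m (Fin d) ℝ) (r : ℝ) :
    Set (EuclideanSpace ℝ (Fin d)) :=
  {x | norm2 B x ≤ r}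

end LinfCoreset

end

open LinfCoreset
open scoped Pointwise

/-! Write `S` for the coreset, `λ` for its final ridge and `ℓ = log (n κ)`. Two facts suffice.
Domination: every row satisfies `(a·x)² ≤ ‖A_S x‖² + λ ‖x‖²` (`sq_le_stored`). Size: `|S| ≤ 144 k
ℓ²` (`card_coreset_le`). The size bound gives `‖A_S x‖₂ ≤ 12 √k ℓ ‖A_S x‖_∞`. Projecting the stored
rows on a `k`-dimensional `V` gives `k λ ≤ |S| max_i d(a_i, V)²`, hence `√λ ≤ 12 Δ ℓ`. The three
claims follow.

Domination is Cauchy–Schwarz for the form `A_SᵀA_S + λI`: a rejected row has score below `1`, and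
enlarging `S` only increases the right-hand side.

Size is a determinant argument with the potential `det (I + A_SᵀA_S / μ)`. A stored row has a
witness `x` at which `‖A_S x‖² + λ‖x‖²` is at most twice `(a·x)²`. When `μ` is comparable to `λ`,
this multiplies the potential by at least `5/4` (`potential_growth`). Hadamard's inequality in a
basis adapted to a matrix of rank at most `k` bounds the potential by `(1 + ‖A‖²/μ)^k exp (k λ / μ)`
(`potential_le`). So only `O(k ℓ)` rows arrive while `λ` stays within a factor two.

The condition number makes the number of such phases `O(ℓ)`. While `λ = 0`, the prefix has rank at
most `k`, so `σ_min` of the next prefix is controlled. This supplies an effective `μ = σ²/(2n)` for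
that phase and the lower bound `σ²/(nk)` once `λ` is nonzero. -/

/-! ### Quadratic forms of the stored rows. -/

open Matrix in
/-- Cauchy–Schwarz for the semi-inner product given by a symmetric matrix. -/
theorem sq_dotProduct_mulVec_le {d : ℕ} {G : Matrix (Fin d) (Fin d) ℝ} (hs : G.IsSymm)
    (hp : ∀ x, 0 ≤ x ⬝ᵥ G *ᵥ x) (x y : Fin d → ℝ) :
    (x ⬝ᵥ G *ᵥ y) ^ 2 ≤ (x ⬝ᵥ G *ᵥ x) * (y ⬝ᵥ G *ᵥ y) := by
  have hsym : y ⬝ᵥ G *ᵥ x = x ⬝ᵥ G *ᵥ y := by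
    rw [dotProduct_mulVec, ← mulVec_transpose, hs.eq, dotProduct_comm]
  have h : ∀ s : ℝ, 0 ≤ (y ⬝ᵥ G *ᵥ y) * (s * s) + (2 * (x ⬝ᵥ G *ᵥ y)) * s + x ⬝ᵥ G *ᵥ x := by
    intro s
    have := hp (x + s • y)
    simp only [mulVec_add, mulVec_smul, add_dotProduct, dotProduct_add, smul_dotProduct,
      dotProduct_smul, smul_eq_mul, hsym] at this
    linarith
  have := discrim_le_zero h
  rw [discrim] at this
  linarith

/-- The sum of squares `‖A_S x‖₂²`. -/
noncomputable def sumSq {n d : ℕ} (A : Matrix (Fin n) (Fin d) ℝ) (S : Finset (Fin n)) (x : Fin d → ℝ) : ℝ :=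
  ∑ i ∈ S, (A i ⬝ᵥ x) ^ 2

section sumSq

variable {n d : ℕ} (A : Matrix (Fin n) (Fin d) ℝ)

theorem sumSq_nonneg (S : Finset (Fin n)) (x : Fin d → ℝ) : 0 ≤ sumSq A S x :=
  Finset.sum_nonneg fun _ _ => sq_nonneg _

theorem sumSq_mono {S T : Finset (Fin n)} (h : S ⊆ T) (x : Fin d → ℝ) :
    sumSq A S x ≤ sumSq A T x :=
  Finset.sum_le_sum_of_subset_of_nonneg h fun _ _ _ => sq_nonneg _

theorem sumSq_insert {S : Finset (Fin n)} {t : Fin n} (h : t ∉ S) (x : Fin d → ℝ) :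
    sumSq A (insert t S) x = (A t ⬝ᵥ x) ^ 2 + sumSq A S x := by
  rw [sumSq, Finset.sum_insert h, sumSq]

theorem sq_le_sumSq {S : Finset (Fin n)} {t : Fin n} (h : t ∈ S) (x : Fin d → ℝ) :
    (A t ⬝ᵥ x) ^ 2 ≤ sumSq A S x :=
  Finset.single_le_sum (f := fun i => (A i ⬝ᵥ x) ^ 2) (fun _ _ => sq_nonneg _) h

theorem dotProduct_self_nonneg' (x : Fin d → ℝ) : 0 ≤ x ⬝ᵥ x :=
  Finset.sum_nonneg fun _ _ => mul_self_nonneg _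

theorem subRows_mulVec_dotProduct_self (S : Finset (Fin n)) (x : Fin d → ℝ) :
    (subRows A S).mulVec x ⬝ᵥ (subRows A S).mulVec x = sumSq A S x := by
  rw [sumSq, ← Finset.sum_coe_sort S]
  refine Finset.sum_congr rfl fun i _ => ?_
  rw [sq]; rfl

open Matrix in
theorem dotProduct_ridgeGram (S : Finset (Fin n)) (μ : ℝ) (x : Fin d → ℝ) :
    x ⬝ᵥ ((subRows A S)ᵀ * subRows A S + μ • (1 : Matrix (Fin d) (Fin d) ℝ)) *ᵥ x
      = sumSq A S x + μ * (x ⬝ᵥ x) := by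
  rw [← subRows_mulVec_dotProduct_self, add_mulVec, dotProduct_add, smul_mulVec, one_mulVec,
    dotProduct_smul, smul_eq_mul, ← mulVec_mulVec, dotProduct_mulVec, vecMul_transpose]

open Matrix in
theorem ridgeGram_isSymm (S : Finset (Fin n)) (μ : ℝ) :
    ((subRows A S)ᵀ * subRows A S + μ • (1 : Matrix (Fin d) (Fin d) ℝ)).IsSymm := by
  simp [IsSymm, transpose_add, transpose_mul]

end sumSq

/-! ### Ridge scores and domination. -/

section score

variable {n d : ℕ} (A : Matrix (Fin n) (Fin d) ℝ)

open Matrix in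
theorem pinv_isSymm (G : Matrix (Fin d) (Fin d) ℝ) : (pinv G).IsSymm := by
  have h : IsSelfAdjoint (pinv G) := cfc_predicate _ G
  rwa [isSelfAdjoint_iff, star_eq_conjTranspose, conjTranspose_eq_transpose_of_trivial] at h

open Matrix in
-- The witness is `x = G⁺ a`, with `G` the ridge Gram matrix; `G⁺ G G⁺ = G⁺` makes both quantities
-- equal to `aᵀ G⁺ a`.
theorem exists_score_witness (k : ℕ) (S : Finset (Fin n)) (a : Fin d → ℝ) :
    ∃ x, a ⬝ᵥ x = score A k S a ∧ sumSq A S x + ridge A k S * (x ⬝ᵥ x) = score A k S a := by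
  refine ⟨_, rfl, ?_⟩
  set G := (subRows A S)ᵀ * subRows A S + ridge A k S • (1 : Matrix (Fin d) (Fin d) ℝ) with hG
  obtain ⟨-, h2, -, -⟩ := pinv_penrose G (ridgeGram_isSymm A S _)
  rw [← dotProduct_ridgeGram, ← hG, score, ← hG]
  conv_rhs => rw [← h2]
  rw [← mulVec_mulVec, ← mulVec_mulVec, dotProduct_mulVec a, ← mulVec_transpose,
    (pinv_isSymm G).eq]

open Matrix in
-- The kernel condition puts `a` in the range of `G`, so `a = G y` with `y = G⁺ a`; Cauchy–Schwarz
-- then bounds `(a·x)²` by the form at `x` times the score.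
theorem sq_le_of_score_lt_one {k : ℕ} {S : Finset (Fin n)} {a : Fin d → ℝ}
    (hr : 0 ≤ ridge A k S)
    (hker : ∀ w, sumSq A S w + ridge A k S * (w ⬝ᵥ w) = 0 → a ⬝ᵥ w = 0)
    (hsc : score A k S a < 1) (x : Fin d → ℝ) :
    (a ⬝ᵥ x) ^ 2 ≤ sumSq A S x + ridge A k S * (x ⬝ᵥ x) := by
  set G := (subRows A S)ᵀ * subRows A S + ridge A k S • (1 : Matrix (Fin d) (Fin d) ℝ) with hG
  have hs : G.IsSymm := ridgeGram_isSymm A S _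
  obtain ⟨h1, -, -, -⟩ := pinv_penrose G hs
  have hQ : ∀ x, x ⬝ᵥ G *ᵥ x = sumSq A S x + ridge A k S * (x ⬝ᵥ x) := dotProduct_ridgeGram A S _
  have hp : ∀ x, 0 ≤ x ⬝ᵥ G *ᵥ x := fun x => by
    rw [hQ]
    exact add_nonneg (sumSq_nonneg A S x) (mul_nonneg hr (dotProduct_self_nonneg' x))
  set y := pinv G *ᵥ a with hy
  have hGp : (G * pinv G)ᵀ = pinv G * G := by
    rw [transpose_mul, (pinv_isSymm G).eq, hs.eq]
  -- For the defect `z = G y - a`, the vector `z - G⁺ G z` lies in the kernel of `G`, hence is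
  -- orthogonal to `a`; this says `z·z = 0`.
  have hay : G *ᵥ y = a := by
    rw [← sub_eq_zero, ← dotProduct_self_eq_zero]
    obtain ⟨z, hz⟩ : ∃ z, z = G *ᵥ y - a := ⟨_, rfl⟩
    rw [← hz]
    have hw : a ⬝ᵥ (z - (pinv G * G) *ᵥ z) = 0 := by
      apply hker
      rw [← hQ, mulVec_sub, mulVec_mulVec, ← mul_assoc, h1, sub_self, dotProduct_zero]
    rw [dotProduct_sub, ← hGp, mulVec_transpose, dotProduct_comm a (z ᵥ* _),
      ← dotProduct_mulVec, ← mulVec_mulVec, ← hy] at hw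
    nth_rw 2 [hz]
    rw [dotProduct_sub, dotProduct_comm z a]
    linarith
  have hcs := sq_dotProduct_mulVec_le hs hp x y
  rw [hay, hQ, dotProduct_comm y a, dotProduct_comm x a] at hcs
  have hq := hp x
  rw [hQ] at hq
  have : a ⬝ᵥ y ≤ 1 := hsc.le
  nlinarith

end score

/-! ### The determinant potential and its growth. -/

section potential

variable {n d : ℕ} (A : Matrix (Fin n) (Fin d) ℝ)

/-- The matrix `I + c A_Sᵀ A_S`. -/
noncomputable def ridgeMat (c : ℝ) (S : Finset (Fin n)) : Matrix (Fin d) (Fin d) ℝ :=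
  1 + ∑ i ∈ S, c • Matrix.vecMulVec (A i) (A i)

open Matrix in
theorem dotProduct_ridgeMat (c : ℝ) (S : Finset (Fin n)) (x : Fin d → ℝ) :
    x ⬝ᵥ ridgeMat A c S *ᵥ x = x ⬝ᵥ x + c * sumSq A S x := by
  rw [ridgeMat, add_mulVec, one_mulVec, dotProduct_add, sum_mulVec, dotProduct_sum, sumSq,
    Finset.mul_sum]
  congr 1
  refine Finset.sum_congr rfl fun i _ => ?_
  rw [smul_mulVec, vecMulVec_mulVec, dotProduct_smul, dotProduct_comm x]
  simp [sq]

open Matrix in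
theorem ridgeMat_isSymm (c : ℝ) (S : Finset (Fin n)) : (ridgeMat A c S).IsSymm := by
  simp [ridgeMat, IsSymm, transpose_add, transpose_sum, transpose_vecMulVec]

open Matrix in
theorem ridgeMat_posDef {c : ℝ} (hc : 0 ≤ c) (S : Finset (Fin n)) : (ridgeMat A c S).PosDef := by
  refine PosDef.of_dotProduct_mulVec_pos ?_ fun x hx => ?_
  · rw [IsHermitian, conjTranspose_eq_transpose_of_trivial, (ridgeMat_isSymm A c S).eq]
  · rw [star_trivial, dotProduct_ridgeMat]
    have h1 : 0 < x ⬝ᵥ x := lt_of_le_of_ne (dotProduct_self_nonneg' x)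
      fun h => hx (dotProduct_self_eq_zero.1 h.symm)
    have := mul_nonneg hc (sumSq_nonneg A S x)
    linarith

/-- The potential `det (I + c A_Sᵀ A_S)`. -/
noncomputable def potential (c : ℝ) (S : Finset (Fin n)) : ℝ := (ridgeMat A c S).det

open Matrix in
theorem potential_insert {c : ℝ} (hc : 0 ≤ c) {S : Finset (Fin n)} {t : Fin n} (ht : t ∉ S) :
    potential A c (insert t S)
      = potential A c S * (1 + c * (A t ⬝ᵥ (ridgeMat A c S)⁻¹ *ᵥ A t)) := by
  have hdet : IsUnit (ridgeMat A c S).det := (ridgeMat_posDef A hc S).det_pos.ne'.isUnit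
  have h : ridgeMat A c (insert t S)
      = ridgeMat A c S + replicateCol Unit (c • A t) * replicateRow Unit (A t) := by
    rw [ridgeMat, Finset.sum_insert ht, ridgeMat, ← smul_vecMulVec, vecMulVec_eq Unit]
    abel
  rw [potential, h, det_add_replicateCol_mul_replicateRow hdet, potential]
  congr 1
  rw [det_unique]
  simp [mul_apply, dotProduct, mulVec, Finset.mul_sum, Finset.sum_mul]
  rw [Finset.sum_comm]
  refine Finset.sum_congr rfl fun i _ => Finset.sum_congr rfl fun j _ => ?_
  ring

theorem potential_pos {c : ℝ} (hc : 0 ≤ c) (S : Finset (Fin n)) : 0 < potential A c S :=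
  (ridgeMat_posDef A hc S).det_pos

theorem potential_empty (c : ℝ) : potential A c ∅ = 1 := by
  simp [potential, ridgeMat]

open Matrix in
theorem potential_le_insert {c : ℝ} (hc : 0 ≤ c) (S : Finset (Fin n)) (t : Fin n) :
    potential A c S ≤ potential A c (insert t S) := by
  by_cases ht : t ∈ S
  · rw [Finset.insert_eq_of_mem ht]
  rw [potential_insert A hc ht]
  have h0 : 0 ≤ A t ⬝ᵥ (ridgeMat A c S)⁻¹ *ᵥ A t := by
    simpa using (ridgeMat_posDef A hc S).inv.posSemidef.dotProduct_mulVec_nonneg (A t)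
  have := potential_pos A hc S
  have := mul_nonneg hc h0
  nlinarith

open Matrix in
-- By the matrix determinant lemma the growth factor is `1 + τ/μ`, where `τ` is the score of the new
-- row against `I + A_SᵀA_S/μ`. Cauchy–Schwarz at the witness `x` forces `τ/μ ≥ 1/4`.
theorem potential_growth {μ : ℝ} (hμ : 0 < μ) {S : Finset (Fin n)} {t : Fin n} (ht : t ∉ S)
    {x : Fin d → ℝ} (hx : A t ⬝ᵥ x ≠ 0)
    (h : sumSq A S x + μ * (x ⬝ᵥ x) ≤ 4 * (A t ⬝ᵥ x) ^ 2) :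
    5 / 4 * potential A μ⁻¹ S ≤ potential A μ⁻¹ (insert t S) := by
  have hc : 0 ≤ μ⁻¹ := (inv_pos.2 hμ).le
  have hpd := ridgeMat_posDef A hc S
  have hdet : IsUnit (ridgeMat A μ⁻¹ S).det := hpd.det_pos.ne'.isUnit
  rw [potential_insert A hc ht]
  set τ := A t ⬝ᵥ (ridgeMat A μ⁻¹ S)⁻¹ *ᵥ A t with hτ
  have hcs := sq_dotProduct_mulVec_le (ridgeMat_isSymm A μ⁻¹ S)
    (fun x => by simpa using hpd.posSemidef.dotProduct_mulVec_nonneg x) x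
    ((ridgeMat A μ⁻¹ S)⁻¹ *ᵥ A t)
  rw [mulVec_mulVec, mul_nonsing_inv _ hdet, one_mulVec, dotProduct_ridgeMat,
    dotProduct_comm x, dotProduct_comm _ (A t), ← hτ] at hcs
  have hpos : 0 < (A t ⬝ᵥ x) ^ 2 := by positivity
  have h1 : x ⬝ᵥ x + μ⁻¹ * sumSq A S x = μ⁻¹ * (sumSq A S x + μ * (x ⬝ᵥ x)) := by
    field_simp; ring
  rw [h1] at hcs
  have hτ0 : 0 ≤ τ := by
    simpa using hpd.inv.posSemidef.dotProduct_mulVec_nonneg (A t)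
  have h2 : 1 / 4 ≤ μ⁻¹ * τ := by
    have h3 : (A t ⬝ᵥ x) ^ 2 ≤ (μ⁻¹ * τ) * (4 * (A t ⬝ᵥ x) ^ 2) := by
      refine hcs.trans ?_
      have := mul_le_mul_of_nonneg_left h (mul_nonneg hc hτ0)
      linarith
    by_contra hlt
    push Not at hlt
    nlinarith
  have := potential_pos A hc S
  nlinarith

end potential

/-! ### Hadamard's inequality. -/

section hadamard

variable {ι : Type*} [Fintype ι] [DecidableEq ι]

/-- Each eigenvalue satisfies `λ ≤ exp (λ - 1)`; multiply over all of them. -/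
theorem det_le_exp_trace {H : Matrix ι ι ℝ} (hH : H.PosSemidef) :
    H.det ≤ Real.exp (H.trace - Fintype.card ι) := by
  have htr : H.trace - Fintype.card ι = ∑ i, (hH.isHermitian.eigenvalues i - 1) := by
    rw [hH.isHermitian.trace_eq_sum_eigenvalues, Finset.sum_sub_distrib]
    simp
  rw [htr, Real.exp_sum, hH.isHermitian.det_eq_prod_eigenvalues]
  refine Finset.prod_le_prod (fun i _ => hH.eigenvalues_nonneg i) fun i _ => ?_
  have := Real.add_one_le_exp (hH.isHermitian.eigenvalues i - 1)
  simpa using this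

open Matrix in
/-- Hadamard's inequality. -/
theorem det_le_prod_diag {H : Matrix ι ι ℝ} (hH : H.PosDef) : H.det ≤ ∏ i, H i i := by
  have hd : ∀ i, 0 < H i i := fun i => hH.diag_pos
  -- Rescaling to unit diagonal makes the trace equal to the size, so the exponential bound becomes
  -- `1`.
  set D : Matrix ι ι ℝ := diagonal fun i => (√(H i i))⁻¹ with hD
  have hK : (D * H * D).PosSemidef := by
    have := hH.posSemidef.conjTranspose_mul_mul_same D
    rwa [hD, diagonal_conjTranspose, star_trivial, ← hD] at this
  have h1 : (D * H * D).trace - Fintype.card ι = 0 := by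
    rw [sub_eq_zero, trace]
    have : ∀ i, (D * H * D).diag i = 1 := by
      intro i
      rw [diag_apply, hD, mul_diagonal, diagonal_mul]
      have h2 := Real.mul_self_sqrt (hd i).le
      have h3 : √(H i i) ≠ 0 := (Real.sqrt_pos.2 (hd i)).ne'
      field_simp
      linarith
    rw [Finset.sum_congr rfl fun i _ => this i]
    simp
  have h2 := det_le_exp_trace hK
  rw [h1, Real.exp_zero, det_mul, det_mul, hD, det_diagonal, Finset.prod_inv_distrib] at h2
  have h3 : (∏ i, √(H i i)) * ∏ i, √(H i i) = ∏ i, H i i := by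
    rw [← Finset.prod_mul_distrib]
    exact Finset.prod_congr rfl fun i _ => Real.mul_self_sqrt (hd i).le
  have h4 : 0 < ∏ i, √(H i i) := Finset.prod_pos fun i _ => Real.sqrt_pos.2 (hd i)
  rw [← h3]
  have h5 : H.det = ((∏ i, √(H i i))⁻¹ * H.det * (∏ i, √(H i i))⁻¹)
      * ((∏ i, √(H i i)) * ∏ i, √(H i i)) := by field_simp
  rw [h5]
  exact mul_le_of_le_one_left (by positivity) h2

end hadamard

/-! ### Low-rank residual and the upper bound on the potential. -/

section residual

theorem sum_sq_dotProduct_orthonormalBasis {d : ℕ}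
    (b : OrthonormalBasis (Fin d) ℝ (EuclideanSpace ℝ (Fin d))) (v : Fin d → ℝ) :
    ∑ j, (v ⬝ᵥ (b j).ofLp) ^ 2 = v ⬝ᵥ v := by
  have := b.sum_sq_norm_inner_right (WithLp.toLp 2 v)
  rw [EuclideanSpace.norm_sq_eq] at this
  simp only [EuclideanSpace.inner_eq_star_dotProduct, star_trivial, Real.norm_eq_abs, sq_abs] at this
  rw [this]
  simp [dotProduct, sq]

open Matrix in
theorem potential_le_prod {n d : ℕ} (A : Matrix (Fin n) (Fin d) ℝ) {c : ℝ} (hc : 0 ≤ c)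
    (S : Finset (Fin n)) (b : OrthonormalBasis (Fin d) ℝ (EuclideanSpace ℝ (Fin d))) :
    potential A c S ≤ ∏ j, (1 + c * sumSq A S (b j).ofLp) := by
  set U : Matrix (Fin d) (Fin d) ℝ := Matrix.of fun j => (b j).ofLp with hU
  have hinner : ∀ i j, (b i).ofLp ⬝ᵥ (b j).ofLp = if i = j then 1 else 0 := by
    intro i j
    have := orthonormal_iff_ite.1 b.orthonormal j i
    rw [EuclideanSpace.inner_eq_star_dotProduct, star_trivial] at this
    rw [this]
    simp [eq_comm]
  have hUU : U * Uᵀ = 1 := by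
    ext i j
    rw [mul_apply', one_apply]
    exact hinner i j
  have hinj : Function.Injective U.vecMul := by
    intro v w h
    have := congrArg (fun u => u ᵥ* Uᵀ) h
    simpa [vecMul_vecMul, hUU] using this
  have hH : (U * ridgeMat A c S * Uᵀ).PosDef := by
    have := (ridgeMat_posDef A hc S).mul_mul_conjTranspose_same hinj
    rwa [conjTranspose_eq_transpose_of_trivial] at this
  have hdet : (U * ridgeMat A c S * Uᵀ).det = potential A c S := by
    rw [det_mul, mul_comm, ← det_mul, ← mul_assoc, mul_eq_one_comm.1 hUU, one_mul, potential]
  rw [← hdet]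
  refine (det_le_prod_diag hH).trans (le_of_eq (Finset.prod_congr rfl fun j _ => ?_))
  have : (U * ridgeMat A c S * Uᵀ) j j = (b j).ofLp ⬝ᵥ ridgeMat A c S *ᵥ (b j).ofLp := by
    rw [dotProduct_mulVec, mul_apply']
    rfl
  rw [this, dotProduct_ridgeMat, hinner, if_pos rfl]

open Matrix in
/-- A matrix of rank at most `k` kills all but `k` vectors of some orthonormal basis. -/
theorem exists_orthonormalBasis_ker {m : Type*} [Fintype m] {d k : ℕ} (X : Matrix m (Fin d) ℝ)
    (hX : X.rank ≤ k) :
    ∃ (b : OrthonormalBasis (Fin d) ℝ (EuclideanSpace ℝ (Fin d))) (s : Finset (Fin d)),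
      sᶜ.card ≤ k ∧ ∀ j ∈ s, X *ᵥ (b j).ofLp = 0 := by
  set W := LinearMap.ker (toEuclideanLin X) with hW
  set w := Module.finrank ℝ W with hw
  have hrank : X.rank + w = d := by
    have := LinearMap.finrank_range_add_finrank_ker (toEuclideanLin X)
    rw [finrank_euclideanSpace_fin, ← hW, ← hw] at this
    have h := X.rank_eq_finrank_range_toLin (PiLp.basisFun 2 ℝ m) (PiLp.basisFun 2 ℝ (Fin d))
    rw [← toLpLin_eq_toLin] at h
    exact h ▸ this
  set B := stdOrthonormalBasis ℝ W with hB
  set v : Fin d → EuclideanSpace ℝ (Fin d) :=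
    fun j => if h : (j : ℕ) < w then (B ⟨j, h⟩ : EuclideanSpace ℝ (Fin d)) else 0 with hv
  have hon : Orthonormal ℝ (Set.domRestrict {j : Fin d | (j : ℕ) < w} v) := by
    have h1 : Orthonormal ℝ fun i => (B i : EuclideanSpace ℝ (Fin d)) :=
      B.orthonormal.comp_linearIsometry W.subtypeₗᵢ
    have h2 := h1.comp (fun j : {j : Fin d | (j : ℕ) < w} => (⟨j.1, j.2⟩ : Fin w))
      (fun i j h => Subtype.ext (Fin.ext (by simpa using h)))
    convert h2 using 1
    funext j
    have := j.2
    simp only [Set.mem_ofPred_eq] at this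
    simp [Set.domRestrict, hv, this]
  obtain ⟨b, hb⟩ := hon.exists_orthonormalBasis_extension_of_card_eq (by simp)
  refine ⟨b, Finset.univ.filter fun j : Fin d => (j : ℕ) < w, ?_, fun j hj => ?_⟩
  · rw [Finset.card_compl, Fintype.card_fin]
    have : (Finset.univ.filter fun j : Fin d => (j : ℕ) < w).card = w := by
      rw [Fin.card_filter_val_lt]
      omega
    omega
  · simp only [Finset.mem_filter, Finset.mem_univ, true_and] at hj
    rw [hb j hj]
    have h1 : toEuclideanLin X (v j) = 0 := by
      simp only [hv, hj, dif_pos]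
      exact (B ⟨j, hj⟩).2
    simpa [toLpLin_apply] using h1

variable {m : Type*} [Fintype m] {d : ℕ}

theorem bddBelow_residual (B : Matrix m (Fin d) ℝ) (k : ℕ) :
    BddBelow (Set.range fun X : {X : Matrix m (Fin d) ℝ // X.rank ≤ k} =>
      ∑ i, ∑ j, (B i j - X.1 i j) ^ 2) :=
  ⟨0, by rintro _ ⟨X, rfl⟩; positivity⟩

instance nonempty_rank_le (k : ℕ) : Nonempty {X : Matrix m (Fin d) ℝ // X.rank ≤ k} :=
  ⟨0, by simp⟩

theorem residualSq_nonneg (B : Matrix m (Fin d) ℝ) (k : ℕ) : 0 ≤ residualSq B k :=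
  Real.iInf_nonneg fun _ => by positivity

theorem residualSq_le (B : Matrix m (Fin d) ℝ) {k : ℕ} (X : Matrix m (Fin d) ℝ)
    (hX : X.rank ≤ k) : residualSq B k ≤ ∑ i, ∑ j, (B i j - X i j) ^ 2 :=
  ciInf_le (bddBelow_residual B k) ⟨X, hX⟩

theorem residualSq_eq_zero (B : Matrix m (Fin d) ℝ) {k : ℕ} (hB : B.rank ≤ k) :
    residualSq B k = 0 :=
  le_antisymm ((residualSq_le B B hB).trans (by simp)) (residualSq_nonneg B k)

theorem residualSq_le_frobenius (B : Matrix m (Fin d) ℝ) (k : ℕ) :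
    residualSq B k ≤ ∑ i, ∑ j, B i j ^ 2 :=
  (residualSq_le B 0 (by simp)).trans (by simp)

variable {n : ℕ} (A : Matrix (Fin n) (Fin d) ℝ)

theorem residualSq_mono {S T : Finset (Fin n)} (h : S ⊆ T) (k : ℕ) :
    residualSq (subRows A S) k ≤ residualSq (subRows A T) k := by
  refine le_ciInf fun X => ?_
  let e : S → T := fun i => ⟨i, h i.2⟩
  refine (residualSq_le _ (X.1.submatrix e id) ((Matrix.rank_submatrix_le _ _ _).trans X.2)).trans ?_
  have he : Function.Injective e := fun i j hij => Subtype.ext (congrArg (fun t : T => (t : Fin n)) hij)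
  have := Finset.sum_map Finset.univ ⟨e, he⟩
    (fun i : T => ∑ j, (subRows A T i j - X.1 i j) ^ 2)
  refine le_trans (le_of_eq ?_) (Finset.sum_le_sum_of_subset_of_nonneg
    (Finset.subset_univ (Finset.univ.map ⟨e, he⟩)) fun _ _ _ => by positivity)
  rw [this]
  rfl

open Matrix in
-- Apply Hadamard in an orthonormal basis of which a competitor `X` kills all but at most `k`
-- vectors. Those exceptions contribute at most `1 + c a` each. On the killed vectors `A_S` acts as
-- `A_S - X`, so by `1 + u ≤ exp u` their product is at most the exponential of `c ‖A_S - X‖_F²`.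
theorem potential_le {c a : ℝ} (hc : 0 ≤ c) (ha0 : 0 ≤ a) (S : Finset (Fin n)) (k : ℕ)
    (ha : ∀ x, sumSq A S x ≤ a * (x ⬝ᵥ x)) :
    potential A c S ≤ (1 + c * a) ^ k * Real.exp (c * residualSq (subRows A S) k) := by
  have hK : 0 < (1 + c * a) ^ k := by positivity
  have key : ∀ X : {X : Matrix S (Fin d) ℝ // X.rank ≤ k},
      potential A c S ≤ (1 + c * a) ^ k
        * Real.exp (c * ∑ i, ∑ j, (subRows A S i j - X.1 i j) ^ 2) := by
    rintro ⟨X, hX⟩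
    obtain ⟨b, s, hs, hb⟩ := exists_orthonormalBasis_ker X hX
    refine (potential_le_prod A hc S b).trans ?_
    rw [← Finset.prod_compl_mul_prod s]
    have hq : ∀ j, 0 ≤ sumSq A S (b j).ofLp := fun j => sumSq_nonneg _ _ _
    refine mul_le_mul ?_ ?_ (Finset.prod_nonneg fun j _ => by have := hq j; positivity) hK.le
    · calc ∏ j ∈ sᶜ, (1 + c * sumSq A S (b j).ofLp) ≤ ∏ j ∈ sᶜ, (1 + c * a) := by
            refine Finset.prod_le_prod (fun j _ => by have := hq j; positivity) fun j _ => ?_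
            have h1 : (b j).ofLp ⬝ᵥ (b j).ofLp = 1 := by
              have := EuclideanSpace.norm_sq_eq (b j)
              rw [b.norm_eq_one] at this
              simp only [Real.norm_eq_abs, sq_abs] at this
              rw [dotProduct]
              simp only [← sq]
              linarith
            have := ha (b j).ofLp
            rw [h1, mul_one] at this
            gcongr
        _ ≤ (1 + c * a) ^ k := by
            rw [Finset.prod_const]
            exact pow_le_pow_right₀ (by nlinarith [mul_nonneg hc ha0]) hs
    · calc ∏ j ∈ s, (1 + c * sumSq A S (b j).ofLp)
          ≤ ∏ j ∈ s, Real.exp (c * sumSq A S (b j).ofLp) := by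
            refine Finset.prod_le_prod (fun j _ => by have := hq j; positivity) fun j _ => ?_
            linarith [Real.add_one_le_exp (c * sumSq A S (b j).ofLp)]
        _ = Real.exp (c * ∑ j ∈ s, sumSq A S (b j).ofLp) := by
            rw [← Real.exp_sum, Finset.mul_sum]
        _ ≤ _ := by
            refine Real.exp_le_exp.2 (mul_le_mul_of_nonneg_left ?_ hc)
            have h2 : ∀ j ∈ s, sumSq A S (b j).ofLp
                = ∑ i : S, ((subRows A S i - X i) ⬝ᵥ (b j).ofLp) ^ 2 := by
              intro j hj
              rw [sumSq, ← Finset.sum_coe_sort S]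
              refine Finset.sum_congr rfl fun i _ => ?_
              have h3 : X i ⬝ᵥ (b j).ofLp = 0 := congrFun (hb j hj) i
              rw [sub_dotProduct, h3, sub_zero]
              rfl
            rw [Finset.sum_congr rfl h2, Finset.sum_comm]
            refine Finset.sum_le_sum fun i _ => ?_
            refine (Finset.sum_le_univ_sum_of_nonneg fun j => sq_nonneg _).trans (le_of_eq ?_)
            rw [sum_sq_dotProduct_orthonormalBasis]
            simp [dotProduct, sq]
  rcases hc.eq_or_lt with rfl | hc'
  · simpa using key ⟨0, by simp⟩
  -- Solving for the Frobenius error turns the family of bounds into a lower bound for the infimum;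
  -- no best approximation need be exhibited.
  have h1 : c⁻¹ * Real.log (potential A c S / (1 + c * a) ^ k) ≤ residualSq (subRows A S) k := by
    refine le_ciInf fun X => ?_
    have := key X
    rw [mul_comm, ← div_le_iff₀ hK] at this
    have h4 := Real.log_le_log (div_pos (potential_pos A hc S) hK) this
    rw [Real.log_exp] at h4
    rwa [inv_mul_le_iff₀ hc']
  rw [inv_mul_le_iff₀ hc', Real.log_le_iff_le_exp (div_pos (potential_pos A hc S) hK),
    div_le_iff₀ hK] at h1
  linarith

open Matrix in
/-- A quadratic lower bound on a subspace of dimension above `k` bounds the residual below. -/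
theorem le_residualSq {S : Finset (Fin n)} {k : ℕ} {s : ℝ} (W : Submodule ℝ (Fin d → ℝ))
    (hW : k < Module.finrank ℝ W) (h : ∀ x ∈ W, s * (x ⬝ᵥ x) ≤ sumSq A S x) :
    s ≤ residualSq (subRows A S) k := by
  refine le_ciInf fun ⟨X, hX⟩ => ?_
  have hker : Module.finrank ℝ (LinearMap.range X.mulVecLin)
      + Module.finrank ℝ (LinearMap.ker X.mulVecLin) = d := by
    rw [LinearMap.finrank_range_add_finrank_ker, Module.finrank_fin_fun]
  have hX' : Module.finrank ℝ (LinearMap.range X.mulVecLin) ≤ k := hX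
  -- The kernel of `X` has codimension at most `k`, so it meets `W`; at a common vector `A_S` and
  -- `A_S - X` agree.
  have hne : W ⊓ LinearMap.ker X.mulVecLin ≠ ⊥ := by
    intro hbot
    have h1 := Submodule.finrank_sup_add_finrank_inf_eq W (LinearMap.ker X.mulVecLin)
    rw [hbot, finrank_bot] at h1
    have h2 := Submodule.finrank_le (W ⊔ LinearMap.ker X.mulVecLin)
    rw [Module.finrank_fin_fun] at h2
    omega
  obtain ⟨x, hx, hx0⟩ := Submodule.exists_mem_ne_zero_of_ne_bot hne
  have hxx : 0 < x ⬝ᵥ x := lt_of_le_of_ne (dotProduct_self_nonneg' x)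
    fun h => hx0 (dotProduct_self_eq_zero.1 h.symm)
  refine le_of_mul_le_mul_right ((h x hx.1).trans ?_) hxx
  rw [Finset.sum_mul, sumSq, ← Finset.sum_coe_sort S]
  refine Finset.sum_le_sum fun i _ => ?_
  have h3 : X i ⬝ᵥ x = 0 := congrFun (LinearMap.mem_ker.1 hx.2) i
  have h4 : A i ⬝ᵥ x = ∑ j, (A i j - X i j) * x j := by
    rw [← sub_zero (A i ⬝ᵥ x), ← h3, ← sub_dotProduct]
    rfl
  rw [h4]
  refine (Finset.sum_mul_sq_le_sq_mul_sq _ _ _).trans (le_of_eq ?_)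
  simp [subRows, dotProduct, sq]

end residual

/-! ### Row spaces and the smallest nonzero singular value. -/

section singular

theorem dotProduct_eq_zero_of_mem_rowSpan {m : Type*} {d : ℕ} {B : Matrix m (Fin d) ℝ} {x z : Fin d → ℝ}
    (hx : x ∈ rowSpan B) (hz : B.mulVec z = 0) : x ⬝ᵥ z = 0 := by
  induction hx using Submodule.span_induction with
  | mem x h => obtain ⟨i, rfl⟩ := h; exact congrFun hz i
  | zero => exact zero_dotProduct z
  | add x y _ _ hx hy => rw [add_dotProduct, hx, hy, add_zero]
  | smul c x _ hx => rw [smul_dotProduct, hx, smul_zero]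

variable {m : Type*} [Fintype m] {d : ℕ} (B : Matrix m (Fin d) ℝ)

theorem finrank_rowSpan : Module.finrank ℝ (rowSpan B) = B.rank :=
  B.rank_eq_finrank_span_row.symm

/-- `B` is injective on its row space, whose dimension is the rank, so the image of the row space is
the whole range. -/
theorem exists_mem_rowSpan_mulVec_eq (x : Fin d → ℝ) :
    ∃ y ∈ rowSpan B, B.mulVec y = B.mulVec x := by
  have hinj : Function.Injective (B.mulVecLin.domRestrict (rowSpan B)) := by
    rw [← LinearMap.ker_eq_bot, LinearMap.ker_eq_bot']
    rintro ⟨y, hy⟩ h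
    exact Subtype.ext (dotProduct_self_eq_zero.1 (dotProduct_eq_zero_of_mem_rowSpan hy h))
  have hle : LinearMap.range (B.mulVecLin.domRestrict (rowSpan B))
      ≤ LinearMap.range B.mulVecLin := by
    rintro _ ⟨y, rfl⟩
    exact ⟨y, rfl⟩
  have heq := Submodule.eq_of_le_of_finrank_eq hle
    ((LinearMap.finrank_range_of_inj hinj).trans (finrank_rowSpan B))
  have hx : B.mulVec x ∈ LinearMap.range (B.mulVecLin.domRestrict (rowSpan B)) := by
    rw [heq]
    exact ⟨x, rfl⟩
  obtain ⟨y, hy⟩ := hx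
  exact ⟨y, y.2, hy⟩

theorem dotProduct_self_eq_norm_sq {ι : Type*} [Fintype ι] (x : ι → ℝ) :
    x ⬝ᵥ x = ‖(WithLp.toLp 2 x : EuclideanSpace ℝ ι)‖ ^ 2 := by
  rw [EuclideanSpace.norm_sq_eq]
  simp [dotProduct, sq]

theorem mulVec_dotProduct_self_le_opNorm (x : Fin d → ℝ) :
    B.mulVec x ⬝ᵥ B.mulVec x ≤ opNorm B ^ 2 * (x ⬝ᵥ x) := by
  rw [dotProduct_self_eq_norm_sq, dotProduct_self_eq_norm_sq, ← mul_pow]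
  refine pow_le_pow_left₀ (norm_nonneg _) ?_ 2
  exact (Matrix.toEuclideanLin B).toContinuousLinearMap.le_opNorm (WithLp.toLp 2 x)

theorem finite_nonzero_singularValues :
    {s : ℝ | s ≠ 0 ∧ ∃ j : ℕ, (Matrix.toEuclideanLin B).singularValues j = s}.Finite := by
  refine ((Matrix.toEuclideanLin B).singularValues.support.finite_toSet.image
    (Matrix.toEuclideanLin B).singularValues).subset ?_
  rintro s ⟨hs, j, rfl⟩
  exact ⟨j, Finsupp.mem_support_iff.2 hs, rfl⟩

theorem sigmaMin_le {j : ℕ} (hj : (Matrix.toEuclideanLin B).singularValues j ≠ 0) :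
    sigmaMin B ≤ (Matrix.toEuclideanLin B).singularValues j :=
  csInf_le (finite_nonzero_singularValues B).bddBelow ⟨hj, j, rfl⟩

theorem sigmaMin_nonneg : 0 ≤ sigmaMin B :=
  Real.sInf_nonneg (by rintro s ⟨-, j, rfl⟩; exact LinearMap.singularValues_nonneg _ j)

theorem sigmaMin_pos {B : Matrix m (Fin d) ℝ} (hB : B ≠ 0) : 0 < sigmaMin B := by
  have hne : {s : ℝ | s ≠ 0 ∧ ∃ j : ℕ, (Matrix.toEuclideanLin B).singularValues j = s}.Nonempty := by
    by_contra h
    rw [Set.not_nonempty_iff_eq_empty, Set.eq_empty_iff_forall_notMem] at h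
    apply hB
    have : (Matrix.toEuclideanLin B).singularValues = 0 := by
      ext j
      by_contra hj
      exact h _ ⟨hj, j, rfl⟩
    rw [LinearMap.singularValues_eq_zero_iff] at this
    exact (LinearEquiv.map_eq_zero_iff _).1 this
  obtain ⟨h0, j, hj⟩ := hne.csInf_mem (finite_nonzero_singularValues B)
  exact lt_of_le_of_ne (sigmaMin_nonneg B) (Ne.symm h0)

/-- Expand in an eigenbasis of `BᵀB`: eigenvectors with singular value `0` lie in the kernel, hence
are orthogonal to `x`, and all others carry at least `σ_min²`. -/
theorem sigmaMin_sq_mul_le {x : Fin d → ℝ} (hx : x ∈ rowSpan B) :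
    sigmaMin B ^ 2 * (x ⬝ᵥ x) ≤ B.mulVec x ⬝ᵥ B.mulVec x := by
  set T := Matrix.toEuclideanLin B with hT
  set hS := T.isSymmetric_adjoint_comp_self
  set b := hS.eigenvectorBasis rfl with hb
  set X : EuclideanSpace ℝ (Fin d) := WithLp.toLp 2 x with hX
  have h1 : ∀ i, inner ℝ (b i) ((LinearMap.adjoint T ∘ₗ T) X)
      = hS.eigenvalues rfl i * inner ℝ (b i) X := by
    intro i
    rw [← hS, hb, hS.apply_eigenvectorBasis, inner_smul_left]
    simp
  have h2 : B.mulVec x ⬝ᵥ B.mulVec x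
      = ∑ i, hS.eigenvalues rfl i * inner ℝ (b i) X ^ 2 := by
    rw [dotProduct_self_eq_norm_sq]
    change ‖T X‖ ^ 2 = _
    rw [← real_inner_self_eq_norm_sq, ← LinearMap.adjoint_inner_right, ← b.sum_inner_mul_inner]
    refine Finset.sum_congr rfl fun i _ => ?_
    have := h1 i
    rw [LinearMap.comp_apply] at this
    rw [this, real_inner_comm]
    ring
  have h3 : x ⬝ᵥ x = ∑ i, inner ℝ (b i) X ^ 2 := by
    rw [dotProduct_self_eq_norm_sq, ← b.sum_sq_norm_inner_right]
    simp [hX]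
  rw [h2, h3, Finset.mul_sum]
  refine Finset.sum_le_sum fun i _ => ?_
  have hsq := T.sq_singularValues_fin rfl i
  by_cases h0 : T.singularValues i = 0
  · have hlam : hS.eigenvalues rfl i = 0 := by rw [← hsq, h0]; simp
    have hTb : T (b i) = 0 := by
      have h5 : (LinearMap.adjoint T ∘ₗ T) (b i) = 0 := by
        rw [hb, hS.apply_eigenvectorBasis, hlam]; simp
      rw [← inner_self_eq_zero (𝕜 := ℝ), ← LinearMap.adjoint_inner_right]
      rw [LinearMap.comp_apply] at h5
      rw [h5, inner_zero_right]
    have h6 : B.mulVec (b i).ofLp = 0 := by simpa [hT, Matrix.toLpLin_apply] using hTb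
    have h7 : inner ℝ (b i) X = 0 := by
      rw [EuclideanSpace.inner_eq_star_dotProduct, star_trivial]
      exact dotProduct_eq_zero_of_mem_rowSpan hx h6
    rw [h7]; simp
  · refine mul_le_mul_of_nonneg_right ?_ (sq_nonneg _)
    rw [← hsq]
    exact pow_le_pow_left₀ (sigmaMin_nonneg B) (sigmaMin_le B h0) 2

end singular

/-! ### Rank and norm bounds for row subsets. -/

section rank

variable {n d : ℕ} (A : Matrix (Fin n) (Fin d) ℝ)

theorem subRows_mulVec_eq_zero_iff (S : Finset (Fin n)) (x : Fin d → ℝ) :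
    (subRows A S).mulVec x = 0 ↔ sumSq A S x = 0 := by
  rw [← subRows_mulVec_dotProduct_self, dotProduct_self_eq_zero]

/-- Were the rank above `k`, the row space would have dimension above `k` and `σ_min² > 0` would
bound the residual below. -/
theorem rank_subRows_le_of_residualSq_eq_zero {S : Finset (Fin n)} {k : ℕ}
    (h : residualSq (subRows A S) k = 0) : (subRows A S).rank ≤ k := by
  by_contra! hlt
  have hne : subRows A S ≠ 0 := by
    rintro h0
    rw [h0, Matrix.rank_zero] at hlt
    omega
  have h1 := le_residualSq A (rowSpan (subRows A S)) (by rwa [finrank_rowSpan]) fun x hx => by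
    rw [← subRows_mulVec_dotProduct_self]
    exact sigmaMin_sq_mul_le _ hx
  have := pow_pos (sigmaMin_pos hne) 2
  linarith

/-- If the kernel of `A_S` is contained in that of `A_T`, then `rank A_T ≤ rank A_S`. -/
theorem rank_subRows_le_of_ker {S T : Finset (Fin n)}
    (h : ∀ x, sumSq A S x = 0 → sumSq A T x = 0) :
    (subRows A T).rank ≤ (subRows A S).rank := by
  have hk : LinearMap.ker (subRows A S).mulVecLin ≤ LinearMap.ker (subRows A T).mulVecLin := by
    intro x hx
    rw [LinearMap.mem_ker, Matrix.mulVecLin_apply, subRows_mulVec_eq_zero_iff] at hx ⊢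
    exact h x hx
  have h1 := Submodule.finrank_mono hk
  have h2 := (subRows A S).mulVecLin.finrank_range_add_finrank_ker
  have h3 := (subRows A T).mulVecLin.finrank_range_add_finrank_ker
  rw [Matrix.rank, Matrix.rank]
  omega

theorem rank_subRows_mono {S T : Finset (Fin n)} (h : S ⊆ T) :
    (subRows A S).rank ≤ (subRows A T).rank :=
  rank_subRows_le_of_ker A fun x hx =>
    le_antisymm ((sumSq_mono A h x).trans hx.le) (sumSq_nonneg A S x)

theorem sumSq_le_opNorm (S : Finset (Fin n)) (x : Fin d → ℝ) :
    sumSq A S x ≤ opNorm A ^ 2 * (x ⬝ᵥ x) := by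
  refine le_trans ((sumSq_mono A (Finset.subset_univ S) x).trans (le_of_eq ?_))
    (mulVec_dotProduct_self_le_opNorm A x)
  simp only [sumSq, dotProduct, sq]
  rfl

theorem opNorm_nonneg : 0 ≤ opNorm A := norm_nonneg _

theorem row_dotProduct_self_le_opNorm (i : Fin n) : A i ⬝ᵥ A i ≤ opNorm A ^ 2 := by
  have h1 := (sq_le_sumSq A (Finset.mem_singleton_self i) (A i)).trans
    (sumSq_le_opNorm A {i} (A i))
  rcases (dotProduct_self_nonneg' (A i)).eq_or_lt with h | h
  · rw [← h]; positivity
  · rw [sq] at h1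
    exact le_of_mul_le_mul_right h1 h

theorem residualSq_le_opNorm (S : Finset (Fin n)) (k : ℕ) :
    residualSq (subRows A S) k ≤ n * opNorm A ^ 2 := by
  refine (residualSq_le_frobenius _ k).trans ?_
  calc ∑ i : S, ∑ j, subRows A S i j ^ 2 ≤ ∑ i : S, opNorm A ^ 2 := by
        refine Finset.sum_le_sum fun i _ => le_trans (le_of_eq ?_) (row_dotProduct_self_le_opNorm A i)
        simp [dotProduct, sq, subRows]
    _ ≤ n * opNorm A ^ 2 := by
        rw [Finset.sum_const, nsmul_eq_mul]
        refine mul_le_mul_of_nonneg_right ?_ (sq_nonneg _)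
        have := Finset.card_le_univ S
        simp only [Finset.card_univ, Fintype.card_coe, Fintype.card_fin] at this ⊢
        exact_mod_cast this

end rank

/-! ### The online condition number. -/

section cond

variable {n d : ℕ} (A : Matrix (Fin n) (Fin d) ℝ)

/-- The denominator `min_i σ_min(A_{1:i})` of the online rank-`k` condition number. -/
noncomputable def minSigma (k : ℕ) : ℝ :=
  sInf {s : ℝ | ∃ i : ℕ, 1 ≤ i ∧ i ≤ n ∧ (prefixRows A (i - 1)).rank ≤ k ∧
    prefixRows A i ≠ 0 ∧ s = sigmaMin (prefixRows A i)}

theorem finite_prefix_sigmaMin (k : ℕ) :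
    {s : ℝ | ∃ i : ℕ, 1 ≤ i ∧ i ≤ n ∧ (prefixRows A (i - 1)).rank ≤ k ∧
      prefixRows A i ≠ 0 ∧ s = sigmaMin (prefixRows A i)}.Finite := by
  refine ((Set.finite_Iic n).image fun i => sigmaMin (prefixRows A i)).subset ?_
  rintro s ⟨i, -, hi, -, -, rfl⟩
  exact ⟨i, hi, rfl⟩

theorem minSigma_le {k t : ℕ} (ht : t < n) (hr : (prefixRows A t).rank ≤ k)
    (hne : prefixRows A (t + 1) ≠ 0) : minSigma A k ≤ sigmaMin (prefixRows A (t + 1)) :=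
  csInf_le (finite_prefix_sigmaMin A k).bddBelow ⟨t + 1, by omega, ht, hr, hne, rfl⟩

/-- Supplies an admissible index, so that the minimum defining the condition number is over a
nonempty set. -/
theorem exists_first_nonzero_prefix {A : Matrix (Fin n) (Fin d) ℝ} (hA : A ≠ 0) :
    ∃ t < n, prefixRows A t = 0 ∧ prefixRows A (t + 1) ≠ 0 := by
  classical
  obtain ⟨i, hi⟩ : ∃ i, A i ≠ 0 := by
    by_contra! h
    exact hA (funext h)
  have hex : ∃ t, prefixRows A (t + 1) ≠ 0 :=
    ⟨i, fun h => hi (congrFun h ⟨i, by simp [firstRows]⟩)⟩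
  refine ⟨Nat.find hex, ?_, ?_, Nat.find_spec hex⟩
  · exact (Nat.find_min' hex (fun h => hi (congrFun h ⟨i, by simp [firstRows]⟩))).trans_lt i.2
  · rcases h : Nat.find hex with _ | t
    · ext i
      exact absurd i.2 (by simp [firstRows])
    · by_contra hne
      have := Nat.find_min hex (m := t) (by omega)
      exact this hne

theorem minSigma_nonneg (k : ℕ) : 0 ≤ minSigma A k :=
  Real.sInf_nonneg (by rintro s ⟨i, -, -, -, -, rfl⟩; exact sigmaMin_nonneg _)

theorem minSigma_pos {A : Matrix (Fin n) (Fin d) ℝ} (hA : A ≠ 0) (k : ℕ) : 0 < minSigma A k := by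
  obtain ⟨t, ht, h0, h1⟩ := exists_first_nonzero_prefix hA
  have hne : {s : ℝ | ∃ i : ℕ, 1 ≤ i ∧ i ≤ n ∧ (prefixRows A (i - 1)).rank ≤ k ∧
      prefixRows A i ≠ 0 ∧ s = sigmaMin (prefixRows A i)}.Nonempty :=
    ⟨_, t + 1, by omega, ht, by simp [h0], h1, rfl⟩
  obtain ⟨i, -, -, -, hne, hs⟩ := hne.csInf_mem (finite_prefix_sigmaMin A k)
  rw [minSigma, hs]
  exact sigmaMin_pos hne

theorem minSigma_sq_mul_le {k t : ℕ} (ht : t < n) (hr : (prefixRows A t).rank ≤ k)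
    (hne : prefixRows A (t + 1) ≠ 0) {x : Fin d → ℝ} (hx : x ∈ rowSpan (prefixRows A (t + 1))) :
    minSigma A k ^ 2 * (x ⬝ᵥ x) ≤ sumSq A (firstRows n (t + 1)) x := by
  rw [← subRows_mulVec_dotProduct_self]
  refine le_trans ?_ (sigmaMin_sq_mul_le _ hx)
  exact mul_le_mul_of_nonneg_right
    (pow_le_pow_left₀ (minSigma_nonneg A k) (minSigma_le A ht hr hne) 2) (dotProduct_self_nonneg' x)

theorem minSigma_le_opNorm {A : Matrix (Fin n) (Fin d) ℝ} (hA : A ≠ 0) (k : ℕ) :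
    minSigma A k ≤ opNorm A := by
  obtain ⟨t, ht, h0, h1⟩ := exists_first_nonzero_prefix hA
  obtain ⟨i, hi⟩ : ∃ i, prefixRows A (t + 1) i ≠ 0 := by
    by_contra! h
    exact h1 (funext h)
  set x := prefixRows A (t + 1) i with hx
  have hxx : 0 < x ⬝ᵥ x := lt_of_le_of_ne (dotProduct_self_nonneg' x)
    fun h => hi (dotProduct_self_eq_zero.1 h.symm)
  have h2 := (minSigma_sq_mul_le A (k := k) ht (by simp [h0]) h1
    (Submodule.subset_span ⟨i, rfl⟩)).trans (sumSq_le_opNorm A _ x)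
  exact le_of_sq_le_sq (le_of_mul_le_mul_right h2 hxx) (opNorm_nonneg A)

theorem onlineCond_eq {A : Matrix (Fin n) (Fin d) ℝ} (hA : A ≠ 0) (k : ℕ) :
    onlineCond A k = opNorm A / minSigma A k := by
  rw [onlineCond, if_neg hA, minSigma]

theorem one_le_onlineCond (k : ℕ) : 1 ≤ onlineCond A k := by
  by_cases hA : A = 0
  · rw [onlineCond, if_pos hA]
  · rw [onlineCond_eq hA, one_le_div (minSigma_pos hA k)]
    exact minSigma_le_opNorm hA k

end cond

/-! ### The streaming algorithm: witnesses, domination, and gap for the ridge. -/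

section algorithm

variable {n d : ℕ} (A : Matrix (Fin n) (Fin d) ℝ) (k : ℕ)

theorem ridge_nonneg (S : Finset (Fin n)) : 0 ≤ ridge A k S :=
  div_nonneg (residualSq_nonneg _ k) (Nat.cast_nonneg k)

theorem ridge_mono {S T : Finset (Fin n)} (h : S ⊆ T) : ridge A k S ≤ ridge A k T :=
  div_le_div_of_nonneg_right (residualSq_mono A h k) (Nat.cast_nonneg k)

variable {k} in
theorem ridge_mul_eq (hk : 1 ≤ k) (S : Finset (Fin n)) :
    k * ridge A k S = residualSq (subRows A S) k := by
  have : (k : ℝ) ≠ 0 := by positivity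
  rw [ridge, mul_div_cancel₀ _ this]

variable {k} in
theorem ridge_eq_zero_iff (hk : 1 ≤ k) (S : Finset (Fin n)) :
    ridge A k S = 0 ↔ (subRows A S).rank ≤ k := by
  have hk0 : (k : ℝ) ≠ 0 := by positivity
  refine ⟨fun h => rank_subRows_le_of_residualSq_eq_zero A ?_, fun h => ?_⟩
  · rw [← ridge_mul_eq A hk, h, mul_zero]
  · rw [ridge, residualSq_eq_zero _ h, zero_div]

theorem step_eq_or (S : Finset (Fin n)) (t : Fin n) :
    step A k S t = insert t S ∨ step A k S t = S := by
  unfold step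
  split_ifs <;> simp

theorem subset_step (S : Finset (Fin n)) (t : Fin n) : S ⊆ step A k S t := by
  rcases step_eq_or A k S t with h | h <;> rw [h]
  exact Finset.subset_insert t S

theorem step_subset (S : Finset (Fin n)) (t : Fin n) : step A k S t ⊆ insert t S := by
  rcases step_eq_or A k S t with h | h <;> rw [h]
  exact Finset.subset_insert t S

/-- Take the component of `a` orthogonal to the row space. -/
theorem exists_orthogonal_of_notMem_rowSpan {S : Finset (Fin n)} {a : Fin d → ℝ}
    (ha : a ∉ rowSpan (subRows A S)) : ∃ x, a ⬝ᵥ x ≠ 0 ∧ sumSq A S x = 0 := by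
  obtain ⟨y, hy, hBy⟩ := exists_mem_rowSpan_mulVec_eq (subRows A S) a
  have hB : (subRows A S).mulVec (a - y) = 0 := by rw [Matrix.mulVec_sub, hBy, sub_self]
  refine ⟨a - y, fun h => ha ?_, (subRows_mulVec_eq_zero_iff A S _).1 hB⟩
  have h1 := dotProduct_eq_zero_of_mem_rowSpan hy hB
  have h2 : (a - y) ⬝ᵥ (a - y) = 0 := by
    nth_rw 1 [sub_dotProduct]
    rw [h, h1, sub_zero]
  rw [sub_eq_zero.1 (dotProduct_self_eq_zero.1 h2)]
  exact hy

variable {k} in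
-- A row outside the row space is witnessed by a kernel vector. Otherwise the score `s` is at least
-- `1/(1+1/k) ≥ 1/2`, so `s ≤ 2 s²` at the score witness.
theorem exists_witness_of_mem_step (hk : 1 ≤ k) {S : Finset (Fin n)} {t : Fin n} (ht : t ∉ S)
    (h : t ∈ step A k S t) :
    ∃ x, A t ⬝ᵥ x ≠ 0 ∧ sumSq A S x + ridge A k S * (x ⬝ᵥ x) ≤ 2 * (A t ⬝ᵥ x) ^ 2 := by
  by_cases h1 : ridge A k S = 0 ∧ A t ∉ rowSpan (subRows A S)
  · obtain ⟨x, hx, hx0⟩ := exists_orthogonal_of_notMem_rowSpan A h1.2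
    exact ⟨x, hx, by rw [hx0, h1.1]; simp; positivity⟩
  by_cases h2 : 1 / (1 + 1 / (k : ℝ)) ≤ score A k S (A t)
  · obtain ⟨x, hx, hQ⟩ := exists_score_witness A k S (A t)
    have hk1 : (1 : ℝ) ≤ k := by exact_mod_cast hk
    have h3 : (1 : ℝ) / 2 ≤ 1 / (1 + 1 / (k : ℝ)) := by
      refine one_div_le_one_div_of_le (by positivity) ?_
      have := (div_le_one (by positivity : (0 : ℝ) < k)).2 hk1
      linarith
    refine ⟨x, ?_, ?_⟩
    · rw [hx]; linarith
    · rw [hQ, hx]; nlinarith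
  · rw [step, if_neg h1, if_neg h2] at h
    exact absurd h ht

variable {k} in
theorem sq_le_of_notMem_step (hk : 1 ≤ k) {S : Finset (Fin n)} {t : Fin n}
    (h : t ∉ step A k S t) (x : Fin d → ℝ) :
    (A t ⬝ᵥ x) ^ 2 ≤ sumSq A S x + ridge A k S * (x ⬝ᵥ x) := by
  have h1 : ¬ (ridge A k S = 0 ∧ A t ∉ rowSpan (subRows A S)) := by
    intro h1
    rw [step, if_pos h1] at h
    exact h (Finset.mem_insert_self t S)
  have h2 : ¬ 1 / (1 + 1 / (k : ℝ)) ≤ score A k S (A t) := by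
    intro h2
    rw [step, if_neg h1, if_pos h2] at h
    exact h (Finset.mem_insert_self t S)
  refine sq_le_of_score_lt_one A (ridge_nonneg A k S) (fun w hw => ?_) ?_ x
  · have hs := sumSq_nonneg A S w
    have hw' := mul_nonneg (ridge_nonneg A k S) (dotProduct_self_nonneg' w)
    by_cases hr : ridge A k S = 0
    · have hmem : A t ∈ rowSpan (subRows A S) := by
        by_contra hne
        exact h1 ⟨hr, hne⟩
      exact dotProduct_eq_zero_of_mem_rowSpan hmem
        ((subRows_mulVec_eq_zero_iff A S w).2 (by linarith))
    · have : ridge A k S * (w ⬝ᵥ w) = 0 := by linarith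
      rw [dotProduct_self_eq_zero.1 ((mul_eq_zero.1 this).resolve_left hr), dotProduct_zero]
  · push Not at h2
    refine h2.trans_le ?_
    rw [div_le_one (by positivity)]
    have : (0 : ℝ) ≤ 1 / k := by positivity
    linarith

/-- The set stored after the first `t` rows have been processed. -/
noncomputable def stored (t : ℕ) : Finset (Fin n) :=
  ((List.finRange n).take t).foldl (step A k) ∅

theorem stored_zero : stored A k 0 = ∅ := rfl

theorem stored_succ (t : Fin n) : stored A k (t + 1) = step A k (stored A k t) t := by
  have ht : (t : ℕ) < (List.finRange n).length := by simp
  rw [stored, List.take_succ_eq_append_getElem ht, List.foldl_append]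
  simp [stored]

theorem stored_self : stored A k n = coreset A k := by
  rw [stored, coreset, List.take_of_length_le (by simp)]

theorem firstRows_succ (t : Fin n) : firstRows n (t + 1) = insert t (firstRows n t) := by
  ext i
  simp only [firstRows, Finset.mem_filter, Finset.mem_univ, true_and, Finset.mem_insert, Fin.ext_iff]
  omega

theorem notMem_firstRows (t : Fin n) : t ∉ firstRows n t := by simp [firstRows]

theorem stored_subset_firstRows {t : ℕ} (ht : t ≤ n) : stored A k t ⊆ firstRows n t := by
  induction t with
  | zero => simp [stored_zero]
  | succ t ih =>
    have h1 := stored_succ A k ⟨t, ht⟩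
    have h2 := firstRows_succ (⟨t, ht⟩ : Fin n)
    simp only at h1 h2
    rw [h1, h2]
    exact (step_subset A k _ _).trans (Finset.insert_subset_insert _ (ih (by omega)))

theorem notMem_stored (t : Fin n) : t ∉ stored A k t := fun h =>
  notMem_firstRows t (stored_subset_firstRows A k t.2.le h)

variable {k} in
/-- Every row processed so far is dominated by the stored rows and the ridge term. -/
theorem sq_le_stored (hk : 1 ≤ k) {t : ℕ} (ht : t ≤ n) :
    ∀ s ∈ firstRows n t, ∀ x : Fin d → ℝ,
      (A s ⬝ᵥ x) ^ 2 ≤ sumSq A (stored A k t) x + ridge A k (stored A k t) * (x ⬝ᵥ x) := by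
  induction t with
  | zero => simp [firstRows]
  | succ t ih =>
    intro s hs x
    have h1 := stored_succ A k ⟨t, ht⟩
    have h2 := firstRows_succ (⟨t, ht⟩ : Fin n)
    simp only at h1 h2
    rw [h2, Finset.mem_insert] at hs
    rw [h1]
    set S := stored A k t with hS
    have hmono : sumSq A S x + ridge A k S * (x ⬝ᵥ x)
        ≤ sumSq A (step A k S ⟨t, ht⟩) x + ridge A k (step A k S ⟨t, ht⟩) * (x ⬝ᵥ x) :=
      add_le_add (sumSq_mono A (subset_step A k S _) x)
        (mul_le_mul_of_nonneg_right (ridge_mono A k (subset_step A k S _))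
          (dotProduct_self_nonneg' x))
    rcases hs with rfl | hs
    · by_cases hmem : (⟨t, ht⟩ : Fin n) ∈ step A k S ⟨t, ht⟩
      · have := mul_nonneg (ridge_nonneg A k (step A k S ⟨t, ht⟩)) (dotProduct_self_nonneg' x)
        linarith [sq_le_sumSq A hmem x]
      · exact (sq_le_of_notMem_step A hk hmem x).trans hmono
    · exact (ih (by omega) s hs x).trans hmono

variable {k} in
theorem sumSq_firstRows_le (hk : 1 ≤ k) {t : ℕ} (ht : t ≤ n)
    (hr : ridge A k (stored A k t) = 0) (x : Fin d → ℝ) :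
    sumSq A (firstRows n t) x ≤ t * sumSq A (stored A k t) x := by
  have hc : (firstRows n t).card = t := by
    rw [firstRows, Fin.card_filter_val_lt]
    omega
  calc sumSq A (firstRows n t) x
      ≤ ∑ _s ∈ firstRows n t, sumSq A (stored A k t) x := by
        refine Finset.sum_le_sum fun s hs => ?_
        have := sq_le_stored A hk ht s hs x
        rwa [hr, zero_mul, add_zero] at this
    _ = t * sumSq A (stored A k t) x := by rw [Finset.sum_const, hc, nsmul_eq_mul]

variable {k} in
theorem rank_prefixRows_le (hk : 1 ≤ k) {t : ℕ} (ht : t ≤ n)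
    (hr : ridge A k (stored A k t) = 0) : (prefixRows A t).rank ≤ k := by
  refine (rank_subRows_le_of_ker A fun x hx => ?_).trans ((ridge_eq_zero_iff A hk _).1 hr)
  have := sumSq_firstRows_le A hk ht hr x
  rw [hx, mul_zero] at this
  exact le_antisymm this (sumSq_nonneg _ _ _)

theorem prefixRows_ne_zero_of_dotProduct_ne_zero {t : Fin n} {x : Fin d → ℝ}
    (hx : A t ⬝ᵥ x ≠ 0) : prefixRows A (t + 1) ≠ 0 := by
  intro h
  have : A t = 0 := congrFun h ⟨t, by simp [firstRows]⟩
  rw [this, zero_dotProduct] at hx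
  exact hx rfl

variable {k} in
theorem exists_witness_of_ridge_eq_zero (hk : 1 ≤ k) {t : Fin n}
    (ht : t ∈ stored A k (t + 1)) (hr : ridge A k (stored A k t) = 0) :
    ∃ x, A t ⬝ᵥ x ≠ 0 ∧ sumSq A (stored A k t) x + minSigma A k ^ 2 / (2 * n) * (x ⬝ᵥ x)
      ≤ 4 * (A t ⬝ᵥ x) ^ 2 := by
  rw [stored_succ] at ht
  obtain ⟨x, hx, hQ⟩ := exists_witness_of_mem_step A hk (notMem_stored A k t) ht
  -- Moving the witness into the row space of the prefix ending with row `t` changes no product with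
  -- its rows, and lets `σ_min` bound its norm. This prefix is admissible because the one before it
  -- has rank at most `k`.
  obtain ⟨y, hy, hBy⟩ := exists_mem_rowSpan_mulVec_eq (prefixRows A (t + 1)) x
  have hrow : ∀ i ∈ firstRows n (t + 1), A i ⬝ᵥ y = A i ⬝ᵥ x := fun i hi => congrFun hBy ⟨i, hi⟩
  have hty : A t ⬝ᵥ y = A t ⬝ᵥ x := hrow t (by simp [firstRows])
  have hSy : sumSq A (stored A k t) y = sumSq A (stored A k t) x := by
    refine Finset.sum_congr rfl fun i hi => ?_
    rw [hrow i]
    rw [firstRows_succ]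
    exact Finset.mem_insert_of_mem (stored_subset_firstRows A k t.2.le hi)
  rw [hr, zero_mul, add_zero] at hQ
  refine ⟨y, by rwa [hty], ?_⟩
  have h1 := minSigma_sq_mul_le A t.2 (rank_prefixRows_le A hk t.2.le hr)
    (prefixRows_ne_zero_of_dotProduct_ne_zero A hx) hy
  rw [firstRows_succ, sumSq_insert A (notMem_firstRows t)] at h1
  have h2 := sumSq_firstRows_le A hk t.2.le hr y
  rw [hSy] at h2 ⊢
  rw [hty] at h1 ⊢
  have hn : ((t : ℕ) : ℝ) + 1 ≤ n := by exact_mod_cast t.2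
  have hn0 : (0 : ℝ) < n := by linarith [Nat.cast_nonneg (α := ℝ) (t : ℕ)]
  -- The earlier rows contribute at most `2 t (a·x)²` and the new one `(a·x)²`, in total at most `2
  -- n (a·x)²`.
  have h3 : minSigma A k ^ 2 / (2 * n) * (y ⬝ᵥ y) ≤ (A t ⬝ᵥ x) ^ 2 := by
    rw [div_mul_eq_mul_div, div_le_iff₀ (by positivity)]
    have h4 : ((t : ℕ) : ℝ) * sumSq A (stored A k t) x ≤ t * (2 * (A t ⬝ᵥ x) ^ 2) :=
      mul_le_mul_of_nonneg_left hQ (Nat.cast_nonneg _)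
    have h5 := mul_le_mul_of_nonneg_right hn (sq_nonneg (A t ⬝ᵥ x))
    nlinarith [sq_nonneg (A t ⬝ᵥ x)]
  nlinarith [sq_nonneg (A t ⬝ᵥ x)]

variable {k} in
-- When the ridge first becomes nonzero, the row space of the current prefix has dimension above
-- `k`. There the prefix form is at least `σ²‖x‖²` and at most `n` times the stored form, which
-- bounds the residual below by `σ²/n`.
theorem ridge_stored_eq_zero_or (hk : 1 ≤ k) {t : ℕ} (ht : t ≤ n) :
    ridge A k (stored A k t) = 0 ∨ minSigma A k ^ 2 / (n * k) ≤ ridge A k (stored A k t) := by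
  induction t with
  | zero =>
    left
    rw [ridge_eq_zero_iff A hk, stored_zero]
    refine (Matrix.rank_le_card_height _).trans ?_
    simp
  | succ t ih =>
    by_cases h0 : ridge A k (stored A k (t + 1)) = 0
    · exact Or.inl h0
    right
    obtain ⟨τ, hτ⟩ : ∃ τ : Fin n, (τ : ℕ) = t := ⟨⟨t, ht⟩, rfl⟩
    subst hτ
    have hsub : stored A k τ ⊆ stored A k (τ + 1) := by
      rw [stored_succ]
      exact subset_step A k _ _
    rcases ih (by omega) with hr | hr
    swap
    · exact hr.trans (ridge_mono A k hsub)
    have hmem : τ ∈ stored A k (τ + 1) := by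
      by_contra hne
      apply h0
      rw [stored_succ] at hne ⊢
      rcases step_eq_or A k (stored A k τ) τ with h | h
      · rw [h] at hne
        exact absurd (Finset.mem_insert_self _ _) hne
      · rw [h, hr]
    have hn0 : (0 : ℝ) < n := by exact_mod_cast (Nat.zero_le _).trans_lt τ.2
    have hk0 : (0 : ℝ) < k := by exact_mod_cast hk
    have hrank : k < (subRows A (stored A k (τ + 1))).rank := by
      by_contra! hle
      exact h0 ((ridge_eq_zero_iff A hk _).2 hle)
    have hrank' := rank_subRows_mono A (stored_subset_firstRows A k (t := τ + 1) τ.2)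
    have hne : prefixRows A (τ + 1) ≠ 0 := by
      obtain ⟨x, hx, -⟩ := exists_witness_of_ridge_eq_zero A hk hmem hr
      exact prefixRows_ne_zero_of_dotProduct_ne_zero A hx
    have key : minSigma A k ^ 2 / n ≤ residualSq (subRows A (stored A k (τ + 1))) k := by
      refine le_residualSq A (rowSpan (prefixRows A (τ + 1)))
        (by rw [finrank_rowSpan]; exact hrank.trans_le hrank') fun x hx => ?_
      have h1 := minSigma_sq_mul_le A τ.2 (rank_prefixRows_le A hk τ.2.le hr) hne hx
      rw [firstRows_succ, sumSq_insert A (notMem_firstRows τ)] at h1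
      have h2 := sumSq_firstRows_le A hk τ.2.le hr x
      have h3 := sumSq_mono A hsub x
      have h4 := sq_le_sumSq A hmem x
      have hn : ((τ : ℕ) : ℝ) + 1 ≤ n := by exact_mod_cast τ.2
      rw [div_mul_eq_mul_div, div_le_iff₀ hn0]
      have h5 := mul_le_mul_of_nonneg_left h3 (Nat.cast_nonneg (α := ℝ) (τ : ℕ))
      have h6 := mul_le_mul_of_nonneg_right hn (sumSq_nonneg A (stored A k (τ + 1)) x)
      linarith
    rw [ridge, ← div_div]
    exact div_le_div_of_nonneg_right key hk0.le

/-- If each stored row with property `P` increases the potential by a factor `5/4`, starting from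
at most `K`, then there are few such rows. -/
theorem card_filter_le_of_growth {μ K : ℝ} (hμ : 0 < μ) (hK : 1 ≤ K) (P : Fin n → Prop)
    [DecidablePred P]
    (hP : ∀ t : Fin n, t ∈ stored A k (t + 1) → P t →
      (∃ x, A t ⬝ᵥ x ≠ 0 ∧ sumSq A (stored A k t) x + μ * (x ⬝ᵥ x) ≤ 4 * (A t ⬝ᵥ x) ^ 2) ∧
        potential A μ⁻¹ (stored A k t) ≤ K) :
    (((coreset A k).filter P).card : ℝ) ≤ 1 + 5 * Real.log K := by
  -- The potential is bounded by `K` only just before a counted row arrives, so the second bound is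
  -- carried along and loses one factor `5/4`.
  have key : ∀ t ≤ n, (5 / 4 : ℝ) ^ ((stored A k t).filter P).card ≤ potential A μ⁻¹ (stored A k t) ∧
      (5 / 4 : ℝ) ^ ((stored A k t).filter P).card ≤ 5 / 4 * K := by
    intro t
    induction t with
    | zero =>
      intro _
      rw [stored_zero, potential_empty]
      simp only [Finset.filter_empty, Finset.card_empty, pow_zero, le_refl, true_and]
      linarith
    | succ t ih =>
      intro ht
      obtain ⟨τ, hτ⟩ : ∃ τ : Fin n, (τ : ℕ) = t := ⟨⟨t, ht⟩, rfl⟩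
      subst hτ
      obtain ⟨h1, h2⟩ := ih (by omega)
      rcases step_eq_or A k (stored A k τ) τ with h | h
      · have hgrow := potential_le_insert A (inv_pos.2 hμ).le (stored A k τ) τ
        have hmem : τ ∈ stored A k (τ + 1) := by
          rw [stored_succ, h]
          exact Finset.mem_insert_self _ _
        have hnot := notMem_stored A k τ
        rw [stored_succ, h, Finset.filter_insert]
        split_ifs with hp
        · obtain ⟨⟨x, hx, hQ⟩, hle⟩ := hP τ hmem hp
          have hg := potential_growth A hμ hnot hx hQ
          rw [Finset.card_insert_of_notMem (fun hm => hnot (Finset.mem_filter.1 hm).1), pow_succ]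
          constructor <;> linarith
        · exact ⟨h1.trans hgrow, h2⟩
      · rw [stored_succ, h]
        exact ⟨h1, h2⟩
  have h := (key n le_rfl).2
  rw [stored_self] at h
  have hl := Real.log_le_log (by positivity) h
  rw [Real.log_pow, Real.log_mul (by norm_num) (by positivity)] at hl
  have h5 : (1 / 5 : ℝ) ≤ Real.log (5 / 4) := by
    have := Real.one_sub_inv_le_log_of_pos (by norm_num : (0 : ℝ) < 5 / 4)
    norm_num at this ⊢
    exact this
  have hK0 := Real.log_nonneg hK
  by_contra! hlt
  nlinarith

end algorithm

/-! ### Size of the coreset. -/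

section count

variable {n d : ℕ} (A : Matrix (Fin n) (Fin d) ℝ) {k : ℕ}

theorem log_mul_onlineCond_ge (hn : 2 ≤ n) : 69 / 100 ≤ Real.log (n * onlineCond A k) := by
  have h2 : (2 : ℝ) ≤ n * onlineCond A k := by
    have h1 := one_le_onlineCond A k
    have h2 : (2 : ℝ) ≤ n := by exact_mod_cast hn
    nlinarith
  have := Real.log_le_log (by norm_num) h2
  linarith [Real.log_two_gt_d9]

theorem opNorm_sq_eq (hA : A ≠ 0) : opNorm A ^ 2 = onlineCond A k ^ 2 * minSigma A k ^ 2 := by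
  have := (minSigma_pos hA k).ne'
  rw [onlineCond_eq hA, div_pow]
  field_simp

open Classical in
-- With `μ = σ²/(2n)` the residual term of the potential bound vanishes and `‖A‖²/μ = 2 n κ²`.
theorem card_filter_ridge_eq_zero_le (hn : 2 ≤ n) (hk : 1 ≤ k) (hA : A ≠ 0) :
    (((coreset A k).filter fun t : Fin n => ridge A k (stored A k t) = 0).card : ℝ)
      ≤ 1 + 15 * k * Real.log (n * onlineCond A k) := by
  have hm := minSigma_pos hA k
  have hn0 : (2 : ℝ) ≤ n := by exact_mod_cast hn
  have hκ := one_le_onlineCond A k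
  set κ := onlineCond A k with hκd
  set μ := minSigma A k ^ 2 / (2 * n) with hμ
  have hμ0 : 0 < μ := by positivity
  have hμa : μ⁻¹ * opNorm A ^ 2 = 2 * n * κ ^ 2 := by
    rw [opNorm_sq_eq A (k := k) hA, ← hκd, hμ]
    field_simp
  have hb : (1 : ℝ) ≤ 1 + 2 * n * κ ^ 2 := by nlinarith [sq_nonneg κ]
  refine (card_filter_le_of_growth A k (K := (1 + 2 * n * κ ^ 2) ^ k) hμ0 (one_le_pow₀ hb) _
    fun t ht hr => ⟨exists_witness_of_ridge_eq_zero A hk ht hr, ?_⟩).trans ?_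
  · have := potential_le A (inv_pos.2 hμ0).le (sq_nonneg (opNorm A)) (stored A k t) k
      (sumSq_le_opNorm A _)
    rwa [← ridge_mul_eq A hk, hr, hμa, mul_zero, mul_zero, Real.exp_zero, mul_one] at this
  · rw [Real.log_pow]
    have h3 : Real.log (1 + 2 * n * κ ^ 2) ≤ 3 * Real.log (n * κ) := by
      have h4 : 3 * Real.log (n * κ) = Real.log ((n * κ) ^ 3) := by rw [Real.log_pow]; norm_num
      rw [h4]
      refine Real.log_le_log (by positivity) ?_
      have h5 : (1 : ℝ) ≤ n * κ ^ 2 := by nlinarith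
      have h6 : (4 : ℝ) ≤ n ^ 2 * κ := by nlinarith
      have h7 : (n * κ) ^ 3 = (n * κ ^ 2) * (n ^ 2 * κ) := by ring
      rw [h7]
      nlinarith
    have hk0 : (0 : ℝ) ≤ k := Nat.cast_nonneg k
    nlinarith

open Classical in
-- Take `μ = 2L`: it is at most `2λ`, so the factor-two witnesses become factor-four ones, and at
-- least `λ`, so the exponential term is at most `exp k`.
theorem card_filter_ridge_mem_Icc_le (hn : 2 ≤ n) (hk : 1 ≤ k) (hA : A ≠ 0) {L : ℝ}
    (hL : minSigma A k ^ 2 / (n * k) ≤ L) :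
    (((coreset A k).filter fun t : Fin n => L ≤ ridge A k (stored A k t) ∧
        ridge A k (stored A k t) ≤ 2 * L).card : ℝ)
      ≤ 1 + 5 * k + 10 * k * Real.log (n * onlineCond A k) := by
  have hm := minSigma_pos hA k
  have hn0 : (2 : ℝ) ≤ n := by exact_mod_cast hn
  have hk0 : (1 : ℝ) ≤ k := by exact_mod_cast hk
  have hκ := one_le_onlineCond A k
  have hlog := log_mul_onlineCond_ge A (k := k) hn
  set κ := onlineCond A k with hκd
  have hL0 : 0 < L := lt_of_lt_of_le (by positivity) hL
  -- If `n < k`, the rank never exceeds `k` and the ridge stays `0`; otherwise `n k ≤ n²`, which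
  -- removes `k` from the logarithm.
  by_cases hkn : n < k
  · have hempty : (coreset A k).filter (fun t : Fin n => L ≤ ridge A k (stored A k t) ∧
        ridge A k (stored A k t) ≤ 2 * L) = ∅ := by
      refine Finset.filter_eq_empty_iff.2 fun t _ h => ?_
      have : ridge A k (stored A k t) = 0 := by
        rw [ridge_eq_zero_iff A hk]
        refine (Matrix.rank_le_card_height _).trans ?_
        have := Finset.card_le_univ (stored A k t)
        simp only [Fintype.card_coe, Fintype.card_fin] at this ⊢
        omega
      linarith [h.1]
    rw [hempty]
    simp only [Finset.card_empty, Nat.cast_zero]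
    positivity
  push Not at hkn
  have hkn' : (k : ℝ) ≤ n := by exact_mod_cast hkn
  have hca : (2 * L)⁻¹ * opNorm A ^ 2 ≤ n ^ 2 * κ ^ 2 / 2 := by
    rw [inv_mul_le_iff₀ (by positivity), opNorm_sq_eq A (k := k) hA, ← hκd]
    rw [div_le_iff₀ (by positivity)] at hL
    have h1 : minSigma A k ^ 2 ≤ L * n ^ 2 :=
      hL.trans (mul_le_mul_of_nonneg_left (by nlinarith) hL0.le)
    nlinarith [sq_nonneg κ]
  have hb : (1 : ℝ) ≤ 1 + n ^ 2 * κ ^ 2 / 2 := by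
    have : (0 : ℝ) ≤ n ^ 2 * κ ^ 2 / 2 := by positivity
    linarith
  refine (card_filter_le_of_growth A k (μ := 2 * L)
    (K := (1 + n ^ 2 * κ ^ 2 / 2) ^ k * Real.exp k) (by positivity)
    (one_le_mul_of_one_le_of_one_le (one_le_pow₀ hb) (Real.one_le_exp (by positivity)))
    (fun t => L ≤ ridge A k (stored A k t) ∧ ridge A k (stored A k t) ≤ 2 * L)
    fun t ht hr => ⟨?_, ?_⟩).trans ?_
  · rw [stored_succ] at ht
    obtain ⟨x, hx, hQ⟩ := exists_witness_of_mem_step A hk (notMem_stored A k t) ht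
    refine ⟨x, hx, ?_⟩
    have h1 := mul_le_mul_of_nonneg_right hr.1 (dotProduct_self_nonneg' x)
    have h2 := sumSq_nonneg A (stored A k t) x
    linarith
  · have hc : 0 ≤ (2 * L)⁻¹ := by positivity
    refine (potential_le A hc (sq_nonneg (opNorm A)) (stored A k t) k (sumSq_le_opNorm A _)).trans ?_
    refine mul_le_mul (pow_le_pow_left₀ (by positivity) (by linarith) k) ?_ (Real.exp_pos _).le
      (by positivity)
    refine Real.exp_le_exp.2 ?_
    rw [← ridge_mul_eq A hk, inv_mul_le_iff₀ (by positivity)]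
    have := mul_le_mul_of_nonneg_left hr.2 (by positivity : (0 : ℝ) ≤ k)
    linarith
  · rw [Real.log_mul (by positivity) (Real.exp_pos _).ne', Real.log_pow, Real.log_exp]
    have h3 : Real.log (1 + n ^ 2 * κ ^ 2 / 2) ≤ 2 * Real.log (n * κ) := by
      have h4 : 2 * Real.log (n * κ) = Real.log ((n * κ) ^ 2) := by rw [Real.log_pow]; norm_num
      rw [h4]
      refine Real.log_le_log (by positivity) ?_
      have h5 : (2 : ℝ) ≤ n * κ := by nlinarith
      nlinarith
    nlinarith

/-- The size of the coreset is `O(k log² (n κ))`. -/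
theorem card_coreset_le (hn : 2 ≤ n) (hk : 1 ≤ k) :
    ((coreset A k).card : ℝ) ≤ 144 * k * Real.log (n * onlineCond A k) ^ 2 := by
  classical
  have hℓ := log_mul_onlineCond_ge A (k := k) hn
  have hk0 : (1 : ℝ) ≤ k := by exact_mod_cast hk
  by_cases hA : A = 0
  · have hempty : coreset A k = ∅ := by
      rw [← stored_self]
      suffices h : ∀ t ≤ n, stored A k t = ∅ from h n le_rfl
      intro t
      induction t with
      | zero => intro _; rfl
      | succ t ih =>
        intro ht
        have h0 := ih (by omega)
        have h1 := stored_succ A k ⟨t, ht⟩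
        simp only at h1
        rw [h1]
        rcases step_eq_or A k (stored A k t) ⟨t, ht⟩ with h | h
        · obtain ⟨x, hx, -⟩ := exists_witness_of_mem_step A hk (notMem_stored A k ⟨t, ht⟩)
            (h ▸ Finset.mem_insert_self _ _)
          exact absurd (zero_dotProduct x) (by rwa [hA] at hx)
        · rw [h, h0]
    rw [hempty]
    simp only [Finset.card_empty, Nat.cast_zero]
    positivity
  have hm := minSigma_pos hA k
  have hκ := one_le_onlineCond A k
  have hn0 : (2 : ℝ) ≤ n := by exact_mod_cast hn
  set ℓ := Real.log (n * onlineCond A k) with hℓd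
  set ρ := minSigma A k ^ 2 / (n * k) with hρ
  have hρ0 : 0 < ρ := by positivity
  -- Since `k λ ≤ n ‖A‖²`, a dyadic class `j` that occurs has `2^j ≤ (n κ)²`, so `j ≤ 2ℓ / log 2 <
  -- 3ℓ`.
  set J := ⌊3 * ℓ⌋₊ with hJ
  set P : ℕ → Fin n → Prop := fun j t => ρ * 2 ^ j ≤ ridge A k (stored A k t) ∧
    ridge A k (stored A k t) ≤ 2 * (ρ * 2 ^ j) with hP
  have hcover : coreset A k ⊆ (coreset A k).filter (fun t : Fin n => ridge A k (stored A k t) = 0) ∪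
      (Finset.range (J + 1)).biUnion fun j => (coreset A k).filter (P j) := by
    intro t ht
    rcases ridge_stored_eq_zero_or A hk t.2.le with h | h
    · exact Finset.mem_union_left _ (Finset.mem_filter.2 ⟨ht, h⟩)
    refine Finset.mem_union_right _ (Finset.mem_biUnion.2 ?_)
    rw [← hρ] at h
    obtain ⟨j, hj1, hj2⟩ := exists_nat_pow_near ((one_le_div hρ0).2 h) (one_lt_two (α := ℝ))
    rw [le_div_iff₀ hρ0] at hj1
    rw [div_lt_iff₀ hρ0] at hj2
    refine ⟨j, ?_, Finset.mem_filter.2 ⟨ht, by linarith, by rw [pow_succ] at hj2; linarith⟩⟩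
    rw [Finset.mem_range, Nat.lt_succ_iff, hJ]
    refine Nat.le_floor ?_
    have h1 : (2 : ℝ) ^ j ≤ (n * onlineCond A k) ^ 2 := by
      have h2 := residualSq_le_opNorm A (stored A k t) k
      rw [← ridge_mul_eq A hk, opNorm_sq_eq A (k := k) hA] at h2
      have h3 := mul_le_mul_of_nonneg_left hj1 (by positivity : (0 : ℝ) ≤ k)
      have h4 : (k : ℝ) * (2 ^ j * ρ) = 2 ^ j * (minSigma A k ^ 2 / n) := by
        rw [hρ]; field_simp
      rw [h4] at h3
      have h5 : (n : ℝ) * (onlineCond A k ^ 2 * minSigma A k ^ 2)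
          = (n * onlineCond A k) ^ 2 * (minSigma A k ^ 2 / n) := by field_simp
      rw [h5] at h2
      exact le_of_mul_le_mul_right (h3.trans h2) (by positivity)
    have h2 := Real.log_le_log (by positivity) h1
    rw [Real.log_pow, Real.log_pow] at h2
    push_cast at h2
    have h3 := Real.log_two_gt_d9
    have h4 : (0 : ℝ) ≤ j := Nat.cast_nonneg j
    rw [← hℓd] at h2
    nlinarith
  have h1 : ((coreset A k).card : ℝ) ≤ (1 + 15 * k * ℓ) + (J + 1) * (1 + 5 * k + 10 * k * ℓ) := by
    have hc := (Finset.card_le_card hcover).trans ((Finset.card_union_le _ _).trans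
      (Nat.add_le_add_left Finset.card_biUnion_le _))
    have hc' : ((coreset A k).card : ℝ) ≤
        (((coreset A k).filter fun t : Fin n => ridge A k (stored A k t) = 0).card : ℝ)
          + ∑ j ∈ Finset.range (J + 1), (((coreset A k).filter (P j)).card : ℝ) := by
      exact_mod_cast hc
    refine hc'.trans (add_le_add (card_filter_ridge_eq_zero_le A hn hk hA) ?_)
    refine (Finset.sum_le_sum fun j _ => card_filter_ridge_mem_Icc_le A hn hk hA
      (L := ρ * 2 ^ j) ?_).trans (le_of_eq ?_)
    · exact le_mul_of_one_le_right hρ0.le (one_le_pow₀ one_le_two)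
    · rw [Finset.sum_const, Finset.card_range, nsmul_eq_mul]
      push_cast
      rfl
  have hJle : (J : ℝ) ≤ 3 * ℓ := Nat.floor_le (by linarith)
  -- The bound `ℓ ≥ 69/100`, from `n ≥ 2`, absorbs the additive constants.
  have hkℓ : 69 / 100 ≤ k * ℓ := by nlinarith
  have h2 : (J : ℝ) + 1 ≤ 9 / 2 * ℓ := by linarith
  have h3 : 1 + 5 * k + 10 * k * ℓ ≤ 19 * (k * ℓ) := by nlinarith
  have h4 : ((J : ℝ) + 1) * (1 + 5 * k + 10 * k * ℓ) ≤ 9 / 2 * ℓ * (19 * (k * ℓ)) :=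
    mul_le_mul h2 h3 (by positivity) (by linarith)
  have h5 : 69 / 100 * (k * ℓ) ≤ ℓ * (k * ℓ) := mul_le_mul_of_nonneg_right hℓ (by positivity)
  nlinarith

end count

/-! ### The ridge against the optimal subspace cost. -/

section cost

variable {n d : ℕ} (A : Matrix (Fin n) (Fin d) ℝ) {k : ℕ}

theorem nonempty_finrank_eq (hkd : k ≤ d) :
    Nonempty {V : Submodule ℝ (EuclideanSpace ℝ (Fin d)) // Module.finrank ℝ V = k} := by
  refine ⟨Submodule.span ℝ (Set.range fun i : Fin k =>
    EuclideanSpace.basisFun (Fin d) ℝ (Fin.castLE hkd i)), ?_⟩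
  rw [finrank_span_eq_card]
  · simp
  · exact (EuclideanSpace.basisFun (Fin d) ℝ).orthonormal.linearIndependent.comp _
      (Fin.castLE_injective hkd)

theorem infDist_le_maxDist (V : Submodule ℝ (EuclideanSpace ℝ (Fin d))) (i : Fin n) :
    Metric.infDist (WithLp.toLp 2 (A i)) (V : Set (EuclideanSpace ℝ (Fin d))) ≤ maxDist A V :=
  le_ciSup (f := fun i => Metric.infDist (WithLp.toLp 2 (A i))
    (V : Set (EuclideanSpace ℝ (Fin d)))) (Set.finite_range _).bddAbove i

theorem maxDist_nonneg (V : Submodule ℝ (EuclideanSpace ℝ (Fin d))) : 0 ≤ maxDist A V :=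
  Real.iSup_nonneg fun _ => Metric.infDist_nonneg

theorem optCost_nonneg : 0 ≤ optCost A k := Real.iInf_nonneg fun V => maxDist_nonneg A V.1

theorem optCost_le (V : Submodule ℝ (EuclideanSpace ℝ (Fin d))) (hV : Module.finrank ℝ V = k) :
    optCost A k ≤ maxDist A V :=
  ciInf_le (f := fun V : {V : Submodule ℝ (EuclideanSpace ℝ (Fin d)) // Module.finrank ℝ V = k} =>
    maxDist A V.1) ⟨0, by rintro _ ⟨V, rfl⟩; exact maxDist_nonneg A V.1⟩ ⟨V, hV⟩

theorem exists_mem_dist_le_maxDist (V : Submodule ℝ (EuclideanSpace ℝ (Fin d))) (i : Fin n) :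
    ∃ y ∈ V, dist (WithLp.toLp 2 (A i)) y ≤ maxDist A V := by
  obtain ⟨y, hy, h⟩ := (Submodule.closed_of_finiteDimensional V).exists_infDist_eq_dist
    ⟨0, V.zero_mem⟩ (WithLp.toLp 2 (A i))
  exact ⟨y, hy, h ▸ infDist_le_maxDist A V i⟩

/-- Replacing each row by a nearest point of `V` gives a competitor of rank at most `k`. -/
theorem residualSq_le_maxDist (S : Finset (Fin n)) (V : Submodule ℝ (EuclideanSpace ℝ (Fin d)))
    (hV : Module.finrank ℝ V = k) :
    residualSq (subRows A S) k ≤ S.card * maxDist A V ^ 2 := by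
  choose y hyV hy using exists_mem_dist_le_maxDist A V
  set X : Matrix S (Fin d) ℝ := Matrix.of fun i => (y i).ofLp with hX
  have hrank : X.rank ≤ k := by
    rw [← finrank_rowSpan]
    set e := (WithLp.linearEquiv 2 ℝ (Fin d → ℝ)).toLinearMap
    have hle : rowSpan X ≤ V.map e := by
      refine Submodule.span_le.2 ?_
      rintro _ ⟨i, rfl⟩
      exact ⟨y i, hyV i, rfl⟩
    exact (Submodule.finrank_mono hle).trans ((Submodule.finrank_map_le e V).trans hV.le)
  refine (residualSq_le _ X hrank).trans ?_
  calc ∑ i : S, ∑ j, (subRows A S i j - X i j) ^ 2 ≤ ∑ _i : S, maxDist A V ^ 2 := by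
        refine Finset.sum_le_sum fun i _ => ?_
        have h1 := pow_le_pow_left₀ dist_nonneg (hy i) 2
        rw [dist_eq_norm, EuclideanSpace.norm_sq_eq] at h1
        simpa [hX, subRows] using h1
    _ = S.card * maxDist A V ^ 2 := by simp

theorem optCost_shift_le (hkd : k ≤ d) (i₀ : Fin n) : optCost (shift A i₀) k ≤ 2 * optCost A k := by
  have := nonempty_finrank_eq (k := k) hkd
  rw [← div_le_iff₀' two_pos]
  refine le_ciInf fun ⟨V, hV⟩ => ?_
  rw [div_le_iff₀' two_pos]
  refine (optCost_le _ V hV).trans (Real.iSup_le (fun i => ?_) ?_)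
  · obtain ⟨y, hy, h⟩ := exists_mem_dist_le_maxDist A V i
    obtain ⟨y₀, hy₀, h₀⟩ := exists_mem_dist_le_maxDist A V i₀
    refine (Metric.infDist_le_dist_of_mem (V.sub_mem hy hy₀)).trans ?_
    have : (WithLp.toLp 2 (shift A i₀ i) : EuclideanSpace ℝ (Fin d))
        = WithLp.toLp 2 (A i) - WithLp.toLp 2 (A i₀) := rfl
    rw [this]
    refine (dist_sub_sub_le _ _ _ _).trans ?_
    linarith
  · have := maxDist_nonneg A V
    positivity

theorem sqrt_ridge_coreset_le (hn : 2 ≤ n) (hk : 1 ≤ k) (hkd : k ≤ d) :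
    √(ridge A k (coreset A k)) ≤ 12 * optCost A k * Real.log (n * onlineCond A k) := by
  have := nonempty_finrank_eq (k := k) hkd
  have hℓ := log_mul_onlineCond_ge A (k := k) hn
  set ℓ := Real.log (n * onlineCond A k) with hℓd
  have hℓ0 : 0 < 12 * ℓ := by linarith
  have hk0 : (0 : ℝ) < k := by exact_mod_cast hk
  -- Proving the bound for every `V` avoids choosing an optimal subspace; the `12` is `√144` from
  -- the size bound.
  have h : √(ridge A k (coreset A k)) / (12 * ℓ) ≤ optCost A k := by
    refine le_ciInf fun ⟨V, hV⟩ => ?_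
    have hD := maxDist_nonneg A V
    rw [div_le_iff₀ hℓ0, Real.sqrt_le_left (by positivity)]
    have h1 := residualSq_le_maxDist A (coreset A k) V hV
    have h2 := mul_le_mul_of_nonneg_right (card_coreset_le A hn hk) (sq_nonneg (maxDist A V))
    rw [← ridge_mul_eq A hk] at h1
    rw [← hℓd] at h2
    refine le_of_mul_le_mul_left (h1.trans (h2.trans (le_of_eq ?_))) hk0
    ring
  rw [div_le_iff₀ hℓ0] at h
  linarith

end cost

/-! ### Norm and width inequalities. -/

section norms

variable {n d : ℕ} (A : Matrix (Fin n) (Fin d) ℝ) {k : ℕ}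

theorem norm2_nonneg {m : Type*} [Fintype m] (B : Matrix m (Fin d) ℝ)
    (x : EuclideanSpace ℝ (Fin d)) : 0 ≤ norm2 B x := norm_nonneg _

theorem normInf_nonneg {m : Type*} [Fintype m] (B : Matrix m (Fin d) ℝ)
    (x : EuclideanSpace ℝ (Fin d)) : 0 ≤ normInf B x := norm_nonneg _

theorem sq_norm2_subRows (S : Finset (Fin n)) (x : EuclideanSpace ℝ (Fin d)) :
    norm2 (subRows A S) x ^ 2 = sumSq A S x.ofLp := by
  rw [← subRows_mulVec_dotProduct_self, dotProduct_self_eq_norm_sq, norm2]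

theorem norm2_smul {m : Type*} [Fintype m] (B : Matrix m (Fin d) ℝ) (c : ℝ)
    (x : EuclideanSpace ℝ (Fin d)) : norm2 B (c • x) = |c| * norm2 B x := by
  rw [norm2, WithLp.ofLp_smul, Matrix.mulVec_smul, WithLp.toLp_smul, norm_smul, Real.norm_eq_abs,
    norm2]

theorem abs_dotProduct_le_normInf {m : Type*} [Fintype m] (B : Matrix m (Fin d) ℝ)
    (x : EuclideanSpace ℝ (Fin d)) (i : m) : |B i ⬝ᵥ x.ofLp| ≤ normInf B x :=
  norm_le_pi_norm (B.mulVec x.ofLp) i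

theorem normInf_le {m : Type*} [Fintype m] {B : Matrix m (Fin d) ℝ}
    {x : EuclideanSpace ℝ (Fin d)} {r : ℝ} (hr : 0 ≤ r) (h : ∀ i, |B i ⬝ᵥ x.ofLp| ≤ r) :
    normInf B x ≤ r :=
  (pi_norm_le_iff_of_nonneg hr).2 h

theorem normInf_subRows_le (S : Finset (Fin n)) (x : EuclideanSpace ℝ (Fin d)) :
    normInf (subRows A S) x ≤ normInf A x :=
  normInf_le (normInf_nonneg A x) fun i => abs_dotProduct_le_normInf A x i

theorem norm2_coreset_le (hn : 2 ≤ n) (hk : 1 ≤ k) (x : EuclideanSpace ℝ (Fin d)) :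
    norm2 (subRows A (coreset A k)) x ≤ 12 * √(k : ℝ) * Real.log (n * onlineCond A k)
      * normInf (subRows A (coreset A k)) x := by
  have hℓ := log_mul_onlineCond_ge A (k := k) hn
  set N := normInf (subRows A (coreset A k)) x with hN
  have hN0 : 0 ≤ N := normInf_nonneg _ _
  have hℓ0 : 0 ≤ Real.log (n * onlineCond A k) := by linarith
  refine le_of_sq_le_sq ?_ (by positivity)
  rw [sq_norm2_subRows]
  calc sumSq A (coreset A k) x.ofLp ≤ ∑ _i ∈ coreset A k, N ^ 2 := by
        refine Finset.sum_le_sum fun i hi => ?_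
        rw [← sq_abs]
        exact pow_le_pow_left₀ (abs_nonneg _)
          (abs_dotProduct_le_normInf (subRows A (coreset A k)) x ⟨i, hi⟩) 2
    _ ≤ 144 * k * Real.log (n * onlineCond A k) ^ 2 * N ^ 2 := by
        rw [Finset.sum_const, nsmul_eq_mul]
        exact mul_le_mul_of_nonneg_right (card_coreset_le A hn hk) (sq_nonneg N)
    _ = _ := by
        rw [mul_pow, mul_pow, mul_pow, Real.sq_sqrt (Nat.cast_nonneg k)]
        norm_num

theorem normInf_le_norm2_coreset (hn : 2 ≤ n) (hk : 1 ≤ k) (hkd : k ≤ d)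
    (x : EuclideanSpace ℝ (Fin d)) :
    normInf A x ≤ norm2 (subRows A (coreset A k)) x
      + 12 * optCost A k * Real.log (n * onlineCond A k) * ‖x‖ := by
  have hℓ := log_mul_onlineCond_ge A (k := k) hn
  have hD := optCost_nonneg A (k := k)
  have hr := sqrt_ridge_coreset_le A hn hk hkd
  have hN := norm2_nonneg (subRows A (coreset A k)) x
  have hrx : 0 ≤ √(ridge A k (coreset A k)) * ‖x‖ := by positivity
  refine le_trans (normInf_le (add_nonneg hN hrx) fun i => ?_)
    (add_le_add le_rfl (mul_le_mul_of_nonneg_right hr (norm_nonneg x)))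
  refine abs_le_of_sq_le_sq ?_ (add_nonneg hN hrx)
  have h1 := sq_le_stored A hk le_rfl i (by simp [firstRows]) x.ofLp
  rw [stored_self, ← sq_norm2_subRows, dotProduct_self_eq_norm_sq, WithLp.toLp_ofLp] at h1
  refine h1.trans ?_
  have h2 := Real.sq_sqrt (ridge_nonneg A k (coreset A k))
  nlinarith [mul_nonneg hN hrx]

theorem normInf_le_normInf_coreset (hn : 2 ≤ n) (hk : 1 ≤ k) (hkd : k ≤ d)
    (x : EuclideanSpace ℝ (Fin d)) :
    normInf A x ≤ 12 * √(k : ℝ) * Real.log (n * onlineCond A k)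
        * normInf (subRows A (coreset A k)) x
      + 12 * optCost A k * Real.log (n * onlineCond A k) * ‖x‖ :=
  (normInf_le_norm2_coreset A hn hk hkd x).trans (add_le_add (norm2_coreset_le A hn hk x) le_rfl)

theorem shift_dotProduct (i₀ i : Fin n) (x : Fin d → ℝ) :
    shift A i₀ i ⬝ᵥ x = A i ⬝ᵥ x - A i₀ ⬝ᵥ x :=
  sub_dotProduct (A i) (A i₀) x

theorem normInf_shift_le_width (i₀ : Fin n) (x : EuclideanSpace ℝ (Fin d)) :
    normInf (shift A i₀) x ≤ width A x := by
  have hup : ∀ i, A i ⬝ᵥ x.ofLp ≤ ⨆ i : Fin n, A.mulVec x.ofLp i := fun i =>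
    le_ciSup (f := fun i => A.mulVec x.ofLp i) (Set.finite_range _).bddAbove i
  have hlo : ∀ i, ⨅ i : Fin n, A.mulVec x.ofLp i ≤ A i ⬝ᵥ x.ofLp := fun i =>
    ciInf_le (f := fun i => A.mulVec x.ofLp i) (Set.finite_range _).bddBelow i
  refine normInf_le ?_ fun i => ?_
  · rw [width]; linarith [hup i₀, hlo i₀]
  · rw [shift_dotProduct, width, abs_le]
    constructor <;> linarith [hup i₀, hlo i₀, hup i, hlo i]

theorem width_le_normInf_shift (i₀ : Fin n) (x : EuclideanSpace ℝ (Fin d)) :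
    width A x ≤ 2 * normInf (shift A i₀) x := by
  have : Nonempty (Fin n) := ⟨i₀⟩
  have h : ∀ i, |A i ⬝ᵥ x.ofLp - A i₀ ⬝ᵥ x.ofLp| ≤ normInf (shift A i₀) x := fun i => by
    rw [← shift_dotProduct]
    exact abs_dotProduct_le_normInf _ x i
  have h1 : ⨆ i : Fin n, A.mulVec x.ofLp i ≤ A i₀ ⬝ᵥ x.ofLp + normInf (shift A i₀) x :=
    ciSup_le fun i => by
      have := (abs_le.1 (h i)).2
      change A i ⬝ᵥ x.ofLp ≤ _
      linarith
  have h2 : A i₀ ⬝ᵥ x.ofLp - normInf (shift A i₀) x ≤ ⨅ i : Fin n, A.mulVec x.ofLp i :=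
    le_ciInf fun i => by
      have := (abs_le.1 (h i)).1
      change _ ≤ A i ⬝ᵥ x.ofLp
      linarith
  rw [width]
  linarith

/-- A bound `w ≤ 2 (c √k ℓ w' + c D ℓ)` in the normalization of the width estimate. -/
theorem div_sub_div_sqrt_le {w w' c ℓ D : ℝ} (hk : 1 ≤ k) (hc : 0 < c) (hℓ : 0 < ℓ)
    (h : w ≤ 2 * (c * √(k : ℝ) * ℓ * w' + c * D * ℓ)) :
    w / (2 * c * √(k : ℝ) * ℓ) - D / √(k : ℝ) ≤ w' := by
  have hs : 0 < √(k : ℝ) := Real.sqrt_pos.2 (by exact_mod_cast hk)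
  rw [sub_le_iff_le_add, div_le_iff₀ (by positivity)]
  refine h.trans (le_of_eq ?_)
  field_simp

end norms

/-! ### Assembly of the three claims. -/

theorem mainTheorem6 :
    ∃ C : ℝ, 0 < C ∧ ∀ (n d k : ℕ) (hn : 2 ≤ n) (_hk : 1 ≤ k) (_hkd : k ≤ d)
      (A : Matrix (Fin n) (Fin d) ℝ),
      -- the two chains of inequalities
      (∀ x : EuclideanSpace ℝ (Fin d), ‖x‖ = 1 →
        norm2 (subRows A (coreset A k)) x / (C * √(k : ℝ) * Real.log (n * onlineCond A k))
            ≤ normInf (subRows A (coreset A k)) x ∧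
        normInf (subRows A (coreset A k)) x ≤ normInf A x ∧
        normInf A x ≤ norm2 (subRows A (coreset A k)) x
            + C * optCost A k * Real.log (n * onlineCond A k) ∧
        normInf A x ≤ C * √(k : ℝ) * Real.log (n * onlineCond A k)
              * normInf (subRows A (coreset A k)) x
            + C * optCost A k * Real.log (n * onlineCond A k)) ∧
      -- width estimation, with the algorithm run on the rows `a_i - a_1`;
      -- the additive error is bounded through the cost of either matrix
      (∀ B : Matrix (Fin n) (Fin d) ℝ, B = shift A ⟨0, by omega⟩ →
        ∀ x : EuclideanSpace ℝ (Fin d), ‖x‖ = 1 →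
          width A x / (2 * C * √(k : ℝ) * Real.log (n * onlineCond B k))
              - optCost A k / √(k : ℝ) ≤ normInf (subRows B (coreset B k)) x ∧
          width A x / (2 * C * √(k : ℝ) * Real.log (n * onlineCond B k))
              - optCost B k / √(k : ℝ) ≤ normInf (subRows B (coreset B k)) x ∧
          normInf (subRows B (coreset B k)) x ≤ width A x) ∧
      -- the ellipsoid
      (optCost A k < 1 / (C * Real.log (n * onlineCond A k)) →
        ∀ E : Set (EuclideanSpace ℝ (Fin d)),
          E = ellipsoid (subRows A (coreset A k))
            (1 - C * Real.log (n * onlineCond A k) * optCost A k) →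
          E ∩ Metric.closedBall 0 1 ⊆ body A ∩ Metric.closedBall 0 1 ∧
          body A ∩ Metric.closedBall 0 1 ⊆
            ((C * √(k : ℝ) * Real.log (n * onlineCond A k)
              / (1 - C * optCost A k * Real.log (n * onlineCond A k))) • E)
              ∩ Metric.closedBall 0 1) := by
  -- The estimates hold with `12`; the doubling pays for `Δ(B) ≤ 2 Δ(A)` in the width estimate.
  refine ⟨24, by norm_num, fun n d k hn hk hkd A => ?_⟩
  have hs : 0 < √(k : ℝ) := Real.sqrt_pos.2 (by exact_mod_cast hk)
  have hℓ0 : ∀ B : Matrix (Fin n) (Fin d) ℝ, 0 < Real.log (n * onlineCond B k) := fun B => by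
    linarith [log_mul_onlineCond_ge B (k := k) hn]
  have hℓ := hℓ0 A
  have hD := optCost_nonneg A (k := k)
  have hDℓ : 0 ≤ optCost A k * Real.log (n * onlineCond A k) := by positivity
  have h2 : ∀ x, norm2 (subRows A (coreset A k)) x
      ≤ 24 * √(k : ℝ) * Real.log (n * onlineCond A k) * normInf (subRows A (coreset A k)) x := by
    intro x
    have h := norm2_coreset_le A hn hk x
    have h0 : 0 ≤ 12 * √(k : ℝ) * Real.log (n * onlineCond A k)
        * normInf (subRows A (coreset A k)) x :=
      mul_nonneg (by positivity) (normInf_nonneg _ _)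
    linarith
  have h3 : ∀ x, ‖x‖ ≤ 1 → normInf A x ≤ norm2 (subRows A (coreset A k)) x
      + 24 * optCost A k * Real.log (n * onlineCond A k) := by
    intro x hx
    have h := normInf_le_norm2_coreset A hn hk hkd x
    nlinarith [norm_nonneg x]
  refine ⟨fun x hx => ⟨?_, normInf_subRows_le A _ x, h3 x hx.le, ?_⟩, ?_, ?_⟩
  · rw [div_le_iff₀' (by positivity)]
    exact h2 x
  · exact (h3 x hx.le).trans (add_le_add (h2 x) le_rfl)
  · rintro B rfl x hx
    set B := shift A ⟨0, by omega⟩ with hB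
    have hw := width_le_normInf_shift A ⟨0, by omega⟩ x
    have hN := normInf_le_normInf_coreset B hn hk hkd x
    rw [← hB] at hw
    rw [hx, mul_one] at hN
    have hDB := optCost_shift_le A hkd ⟨0, by omega⟩
    rw [← hB] at hDB
    have hDB0 := optCost_nonneg B (k := k)
    have hℓB := hℓ0 B
    have hN0 : 0 ≤ √(k : ℝ) * Real.log (n * onlineCond B k) * normInf (subRows B (coreset B k)) x :=
      mul_nonneg (by positivity) (normInf_nonneg _ _)
    have hDBℓ := mul_le_mul_of_nonneg_right hDB hℓB.le
    have hDBℓ0 := mul_nonneg hDB0 hℓB.le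
    refine ⟨div_sub_div_sqrt_le hk (by norm_num) hℓB ?_,
      div_sub_div_sqrt_le hk (by norm_num) hℓB ?_,
      (normInf_subRows_le B _ x).trans (normInf_shift_le_width A _ x)⟩ <;> linarith
  · rintro hΔ E rfl
    rw [lt_div_iff₀ (by positivity)] at hΔ
    have hr : 0 < 1 - 24 * optCost A k * Real.log (n * onlineCond A k) := by linarith
    refine ⟨fun x ⟨hxE, hx⟩ => ⟨?_, hx⟩, fun x ⟨hxK, hx⟩ => ⟨?_, hx⟩⟩
    · have h := h3 x (by simpa using hx)
      have hE : norm2 (subRows A (coreset A k)) x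
        ≤ 1 - 24 * Real.log (n * onlineCond A k) * optCost A k := hxE
      change normInf A x ≤ 1
      linarith
    · have hK : normInf A x ≤ 1 := hxK
      set c := 24 * √(k : ℝ) * Real.log (n * onlineCond A k)
        / (1 - 24 * optCost A k * Real.log (n * onlineCond A k)) with hc
      have hc0 : 0 < c := by positivity
      rw [Set.mem_smul_set_iff_inv_smul_mem₀ hc0.ne']
      change norm2 _ _ ≤ _
      rw [norm2_smul, abs_of_pos (inv_pos.2 hc0), inv_mul_le_iff₀ hc0]
      -- The dilation cancels the radius of `E`, so membership reduces to `‖A_S x‖₂ ≤ 24 √k ℓ`.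
      have h4 : c * (1 - 24 * Real.log (n * onlineCond A k) * optCost A k)
          = 24 * √(k : ℝ) * Real.log (n * onlineCond A k) := by
        rw [mul_right_comm 24 (Real.log _), hc, div_mul_cancel₀ _ hr.ne']
      rw [h4]
      exact (h2 x).trans (mul_le_of_le_one_right (by positivity)
        ((normInf_subRows_le A _ x).trans hK))
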